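/- For $\kappa\in\mathbb{C}$ let $E_\kappa(z)=\exp(z)+\kappa$, let $I(E_\kappa)=\{z\in\mathbb{C}:|E_\kappa^n(z)|\to\infty\}$, and let $F(t)=e^t-1$ for $t\ge 0$. An external address is a sequence $s=s_1s_2s_3\dots$ of integers; it is bounded if its entries are bounded, and $\sigma(s_1s_2s_3\dots)=s_2s_3s_4\dots$. A point $z$ has external address $s$ (under $E_\kappa$) if $\operatorname{Im}E_\kappa^{n-1}(z)\in((2s_n-1)\pi,(2s_n+1)\pi)$ for all $n\ge 1$. For a bounded address $s$, the dynamic ray $g_s^\kappa:(t_s^\kappa,\infty)\to I(E_\kappa)$, with $t_s^\kappa\ge 0$, is the unique maximal continuous curve (that is, every other such curve on an interval $(b,\infty)$, $b\ge 0$, is a restriction of it) such that $g_s^\kappa(t)$ has external address $s$ for all sufficiently large $t$, and $\operatorname{Re}E_\kappa^n(g_s^\kappa(t))=F^n(t)+o(1)$ as $n$ or $t$ tends to $\infty$, uniformly on $[t_0,\infty)$ for every $t_0>t_s^\kappa$. The ray $g_s^\kappa$ lands if $t_s^\kappa=0$ and the limit $\lim_{t\to 0^+}g_s^\kappa(t)$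 exists in $\mathbb{C}$; this limit is its landing point. The parameter ray at address $s$ is $\mathcal{G}_s=\{\kappa\in\mathbb{C}:\kappa\in g_s^\kappa((t_s^\kappa,\infty))\}$. Theorem. Let $s$ be a bounded external address, and let $W$ be a connected component of $$\mathbb{C}\setminus\overline{\bigcup_{n\ge 1}\mathcal{G}_{\sigma^n(s)}},$$ where the closure is taken in $\mathbb{C}$. Suppose that $g_s^{\kappa_0}$ lands for some $\kappa_0\in W$. Then $g_s^\kappa$ lands for every $\kappa\in W$, and the landing point of $g_s^\kappa$ is a holomorphic function of $\kappa\in W$. -/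

import Mathlib

open Filter Topology Set

namespace ExpRays

/-- The exponential map `E_κ(z) = exp z + κ`. -/
noncomputable def E (κ z : ℂ) : ℂ := Complex.exp z + κ

/-- The model of exponential growth `F(t) = exp t - 1`; it is only ever used for `t ≥ 0`. -/
noncomputable def F (t : ℝ) : ℝ := Real.exp t - 1

/-- The set `I(E_κ)` of escaping points. -/
def escapingSet (κ : ℂ) : Set ℂ :=
  {z | Tendsto (fun n : ℕ => ‖(E κ)^[n] z‖) atTop atTop}

/-- External addresses `s₁ s₂ s₃ …` are sequences of integers; the entry `s₁` is `s 0`. -/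
abbrev Address : Type := ℕ → ℤ

/-- The shift map `σ(s₁ s₂ s₃ …) = s₂ s₃ s₄ …`. -/
def shift (s : Address) : Address := fun k => s (k + 1)

/-- The address has bounded entries. -/
def IsBoundedAddress (s : Address) : Prop := ∃ M : ℤ, ∀ k, |s k| ≤ M

/-- The point `z` has external address `s` under `E_κ`. -/
def HasAddress (κ : ℂ) (s : Address) (z : ℂ) : Prop :=
  ∀ n : ℕ, ((E κ)^[n] z).im ∈
    Ioo ((2 * (s n : ℝ) - 1) * Real.pi) ((2 * (s n : ℝ) + 1) * Real.pi)

/-- `g` restricted to `(a, ∞)`, where `a ≥ 0`, is a curve of escaping points of `E_κ` whose points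
`g t` have address `s` for all large `t`, with `Re (E_κ^n (g t)) = F^n t + o(1)` as `n` or `t`
tends to `∞`. As usual the estimate is uniform as long as `t` stays away from the endpoint `a`
(it cannot be uniform up to `a` for every ray). -/
structure IsRayCurve (κ : ℂ) (s : Address) (a : ℝ) (g : ℝ → ℂ) : Prop where
  nonneg : 0 ≤ a
  cont : ContinuousOn g (Ioi a)
  escaping : ∀ t, a < t → g t ∈ escapingSet κ
  address : ∃ T, a < T ∧ ∀ t, T ≤ t → HasAddress κ s (g t)
  asymptotics : ∀ t₀, a < t₀ → ∀ ε : ℝ, 0 < ε → ∃ R : ℝ, ∀ (n : ℕ) (t : ℝ), t₀ ≤ t →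
    (R ≤ (n : ℝ) ∨ R ≤ t) → |((E κ)^[n] (g t)).re - F^[n] t| < ε

/-- `g` on `(a, ∞)` is the dynamic ray of `E_κ` at address `s`, and `a` is its starting potential:
it is the maximal curve as above, every other one being a restriction of it.
The values of `g` outside `(a, ∞)` are irrelevant. -/
def IsDynamicRay (κ : ℂ) (s : Address) (a : ℝ) (g : ℝ → ℂ) : Prop :=
  IsRayCurve κ s a g ∧
    ∀ (b : ℝ) (h : ℝ → ℂ), IsRayCurve κ s b h → a ≤ b ∧ EqOn h g (Ioi b)

/-- The dynamic ray of `E_κ` at address `s` lands at `z`: its starting potential is `0`, and it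
converges to `z` as the potential decreases to `0`. -/
def LandsAt (κ : ℂ) (s : Address) (z : ℂ) : Prop :=
  ∃ g : ℝ → ℂ, IsDynamicRay κ s 0 g ∧ Tendsto g (𝓝[>] 0) (𝓝 z)

/-- The dynamic ray of `E_κ` at address `s` lands. -/
def Lands (κ : ℂ) (s : Address) : Prop := ∃ z, LandsAt κ s z

/-- The parameter ray at address `s`: the set of all `κ` that lie on the dynamic ray of `E_κ` at
address `s`. -/
def parameterRay (s : Address) : Set ℂ :=
  {κ | ∃ (a : ℝ) (g : ℝ → ℂ), IsDynamicRay κ s a g ∧ κ ∈ g '' Ioi a}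

end ExpRays

/-!
For `κ` in the open set `U`, no ray at an address `σⁿ s`, `n ≥ 1`, passes through the singular value
`κ`. Hence the rays at `s`, which always exist at large potentials (as limits of pullbacks of model
points, `isRayFamily_tailRay`), can be pulled back along `E κ` down to every positive potential:
over a disc of parameters one lifts `(κ, t) ↦ g_{σ s}^κ(F t) - κ` through `exp` on a convex set
(`IsRayFamily.exists_pullback`). The resulting curves are identified with *the* dynamic rays by
uniqueness (`IsRayCurve.eqOn`: far to the right `E κ` expands, so that two orbits with the same
address and the same asymptotics coincide). So for `κ ∈ U` the ray `g_s^κ` starts at potential `0`,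
and `f_t(κ) = g_s^κ(t)` is holomorphic in `κ ∈ U` (`exists_isDynamicRay_zero`).

Landing is then carried along `W` as in the `λ`-lemma for holomorphic motions. Points of a ray
at different potentials are distinct, even modulo `2πi` (`IsRayCurve.ne_add_two_pi_I`), so
`(f_t - f_1) / (2πi)` omits every integer. A Schottky-type bound (`norm_le_cosh_of_omits_int`) makes
the `f_t` comparable on a disc about any parameter at which `f_t` converges as `t → 0`, and since
the differences `f_t - f_{t'}` have no zeros, Harnack's inequality
(`norm_le_of_ne_zero_of_norm_lt`) spreads their convergence to `0` from the centre of the disc to a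
smaller disc. The radius of that disc is a fixed fraction of the distance to the boundary of `W`, so
the set of parameters where `f_t` converges is open and closed in `W`; the limit is holomorphic as a
locally uniform limit.

The Schottky-type bound comes from Bloch's argument: a function `φ` omitting the integers equals
`cosh ℓ` with `ℓ` holomorphic, and the image of `ℓ` contains no disc of radius `4` because
`cosh⁻¹(ℤ)` meets all of these (`exists_cosh_eq_int_near`); this bounds `ℓ'`
(`norm_deriv_le_of_image_contains_no_ball`).
-/

namespace ExpRays

open Metric

/-! ### Branches of the logarithm -/

/-- A continuous logarithm of a holomorphic function is holomorphic. -/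
theorem differentiableOn_of_exp_comp {U : Set ℂ} (hU : IsOpen U) {L h : ℂ → ℂ}
    (hL : ContinuousOn L U) (hh : DifferentiableOn ℂ h U)
    (hexp : ∀ z ∈ U, Complex.exp (L z) = h z) : DifferentiableOn ℂ L U := by
  intro x hx
  have hLx : ContinuousAt L x := hL.continuousAt (hU.mem_nhds hx)
  have hhx : DifferentiableAt ℂ h x := hh.differentiableAt (hU.mem_nhds hx)
  have hx0 : h x ≠ 0 := by rw [← hexp x hx]; exact Complex.exp_ne_zero _
  have hd : DifferentiableAt ℂ (fun z => Complex.log (h z / h x) + L x) x := by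
    refine DifferentiableAt.add_const _ (DifferentiableAt.clog (hhx.div_const _) ?_)
    rw [div_self hx0]; exact Complex.one_mem_slitPlane
  have hev : L =ᶠ[𝓝 x] fun z => Complex.log (h z / h x) + L x := by
    have h1 : ∀ᶠ z in 𝓝 x, L z ∈ ball (L x) 1 := hLx (ball_mem_nhds _ one_pos)
    filter_upwards [h1, hU.mem_nhds hx] with z hz hzU
    rw [← hexp z hzU, ← hexp x hx, ← Complex.exp_sub]
    have him : |(L z - L x).im| < 1 := lt_of_le_of_lt (Complex.abs_im_le_norm _)
      (by simpa [dist_eq_norm] using hz)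
    have h3 := Real.pi_gt_three
    rw [abs_lt] at him
    rw [Complex.log_exp (by linarith) (by linarith)]
    ring
  exact (hd.congr_of_eventuallyEq hev).differentiableWithinAt

theorem isSimplyConnected_of_convex {V : Type*} [AddCommGroup V] [Module ℝ V]
    [TopologicalSpace V] [ContinuousAdd V] [ContinuousSMul ℝ V] {A : Set V} (hA : Convex ℝ A)
    (hne : A.Nonempty) : IsSimplyConnected A := by
  have := hA.contractibleSpace hne
  exact (inferInstance : SimplyConnectedSpace A)

theorem exists_log_on_ball {c : ℂ} {r : ℝ} {h : ℂ → ℂ}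
    (hh : DifferentiableOn ℂ h (ball c r)) (h0 : ∀ z ∈ ball c r, h z ≠ 0) :
    ∃ L : ℂ → ℂ, DifferentiableOn ℂ L (ball c r) ∧ ∀ z ∈ ball c r, Complex.exp (L z) = h z := by
  rcases le_or_gt r 0 with hr | hr
  · refine ⟨0, ?_, ?_⟩ <;> simp [ball_eq_empty.2 hr]
  have hsc : IsSimplyConnected (ball c r) := by
    exact isSimplyConnected_of_convex (convex_ball c r) ⟨c, mem_ball_self hr⟩
  obtain ⟨L, hL, hexp⟩ := Complex.exists_continuousOn_eqOn_exp_comp hsc isOpen_ball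
    hh.continuousOn (by rintro ⟨z, hz, hz'⟩; exact h0 z hz hz')
  exact ⟨L, differentiableOn_of_exp_comp isOpen_ball hL hh hexp, hexp⟩

/-! ### A Schottky-type theorem -/

/-- Bloch's theorem in contrapositive form: if the image of `h` contains no ball of radius `B`, then
`h'` is bounded on the half-size ball. One maximizes `|h'(z)|` times the distance of `z` to a circle;
near a maximum point `a`, `h'` is at most `2 |h'(a)|`, so that `h` is close to its linearization and
its image contains a ball of radius comparable to that maximum. -/
theorem norm_deriv_le_of_image_contains_no_ball {c : ℂ} {r B : ℝ} {h : ℂ → ℂ}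
    (hr : 0 < r) (hh : DifferentiableOn ℂ h (ball c r))
    (homit : ∀ w, ∃ p ∈ ball w B, p ∉ h '' ball c r) :
    ∀ z ∈ closedBall c (r / 2), ‖deriv h z‖ ≤ 192 * B / r := by
  have hB : 0 < B := by
    obtain ⟨p, hp, -⟩ := homit 0
    exact pos_of_mem_ball hp
  have hsub : closedBall c (3 * r / 4) ⊆ ball c r := closedBall_subset_ball (by linarith)
  have hdc : ContinuousOn (deriv h) (ball c r) := (hh.deriv isOpen_ball).continuousOn
  obtain ⟨a, ha, hmax⟩ := (isCompact_closedBall c (3 * r / 4)).exists_isMaxOn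
    ⟨c, mem_closedBall_self (by linarith)⟩
    (f := fun z => (3 * r / 4 - dist z c) * ‖deriv h z‖)
    ((by fun_prop : Continuous fun z => 3 * r / 4 - dist z c).continuousOn.mul
      (hdc.mono hsub).norm)
  have hmax' : ∀ z ∈ closedBall c (3 * r / 4), (3 * r / 4 - dist z c) * ‖deriv h z‖ ≤
      (3 * r / 4 - dist a c) * ‖deriv h a‖ := hmax
  suffices hP : (3 * r / 4 - dist a c) * ‖deriv h a‖ ≤ 48 * B by
    intro z hz
    have h1 := (hmax' z (closedBall_subset_closedBall (by linarith) hz)).trans hP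
    rw [mem_closedBall] at hz
    rw [le_div_iff₀ hr]
    nlinarith [norm_nonneg (deriv h z)]
  rw [mem_closedBall] at ha
  rcases eq_or_lt_of_le ha with hac | hac
  · rw [hac]; simp; positivity
  by_cases hd0 : deriv h a = 0
  · rw [hd0]; simp; positivity
  set d := ‖deriv h a‖ with hd
  have hdpos : 0 < d := norm_pos_iff.2 hd0
  set ρ := (3 * r / 4 - dist a c) / 2 with hρ
  have hρ0 : 0 < ρ := by rw [hρ]; linarith
  have hball : ball a ρ ⊆ ball c (3 * r / 4) := by
    apply ball_subset_ball'; rw [hρ]; linarith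
  have hball' : ball a ρ ⊆ ball c r := hball.trans (ball_subset_closedBall.trans hsub)
  have hder : ∀ z ∈ ball a ρ, ‖deriv h z‖ ≤ 2 * d := by
    intro z hz
    have h1 := hmax' z (ball_subset_closedBall (hball hz))
    have h2 : ρ ≤ 3 * r / 4 - dist z c := by
      have := dist_triangle z a c
      rw [mem_ball] at hz
      rw [hρ] at hz ⊢; linarith
    have h3 : 3 * r / 4 - dist a c = 2 * ρ := by rw [hρ]; ring
    rw [h3] at h1
    have h4 : ρ * ‖deriv h z‖ ≤ ρ * (2 * d) := by
      nlinarith [norm_nonneg (deriv h z)]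
    exact le_of_mul_le_mul_left h4 hρ0
  have hdiff : ∀ z ∈ ball a ρ, DifferentiableAt ℂ h z := fun z hz =>
    hh.differentiableAt (isOpen_ball.mem_nhds (hball' hz))
  -- The deviation of `h` from its linearization at `a`.
  set g : ℂ → ℂ := fun z => h z - deriv h a * (z - a) with hg
  have hgd : DifferentiableOn ℂ g (ball a ρ) :=
    (hh.mono hball').sub (by fun_prop)
  have hga : g a = h a := by simp [hg]
  have hmaps : MapsTo g (ball a ρ) (closedBall (g a) (3 * d * ρ)) := by
    intro z hz
    have h1 : ‖h z - h a‖ ≤ 2 * d * ‖z - a‖ :=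
      (convex_ball a ρ).norm_image_sub_le_of_norm_deriv_le hdiff hder (mem_ball_self hρ0) hz
    rw [mem_closedBall, dist_eq_norm, hga]
    have h2 : g z - h a = (h z - h a) - deriv h a * (z - a) := by simp only [hg]; ring
    rw [h2]
    refine (norm_sub_le _ _).trans ?_
    rw [norm_mul, ← hd]
    have h3 : ‖z - a‖ ≤ ρ := by rw [mem_ball, dist_eq_norm] at hz; exact hz.le
    nlinarith
  -- Since `g - g a` vanishes to second order at `a`, the Schwarz lemma gives a quadratic bound.
  have hlo : (g · - g a) =o[𝓝 a] (fun w => ‖w - a‖ ^ 1) := by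
    have h1 := (hdiff a (mem_ball_self hρ0)).hasDerivAt.isLittleO
    simp only [pow_one]
    refine Asymptotics.IsLittleO.norm_right ?_
    refine h1.congr_left fun z => ?_
    simp only [hg, smul_eq_mul]; ring
  have hquad : ∀ z ∈ sphere a (ρ / 6), d * ρ / 12 ≤ ‖h z - h a‖ := by
    intro z hz
    have hz' : z ∈ ball a ρ := by
      rw [mem_sphere] at hz; rw [mem_ball, hz]; linarith
    have h1 := Complex.dist_le_mul_div_pow_of_mapsTo_ball_of_isLittleO hgd hmaps hlo hz'
    rw [mem_sphere] at hz
    have h5 : dist z a / ρ = 1 / 6 := by rw [hz]; field_simp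
    rw [h5, dist_eq_norm, hga] at h1
    have h2 : deriv h a * (z - a) = (h z - h a) - (g z - h a) := by simp only [hg]; ring
    have h3 : d * (ρ / 6) ≤ ‖h z - h a‖ + ‖g z - h a‖ := by
      rw [hd, ← hz, dist_eq_norm, ← norm_mul, h2]
      exact norm_sub_le _ _
    norm_num at h1
    linarith
  have himg : ball (h a) (d * ρ / 12 / 2) ⊆ h '' closedBall a (ρ / 6) := by
    refine DiffContOnCl.ball_subset_image_closedBall ?_ (by positivity) hquad ?_
    · apply DifferentiableOn.diffContOnCl
      rw [closure_ball a (by positivity)]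
      exact (hh.mono hball').mono (closedBall_subset_ball (by linarith))
    · exact ((hdiff a (mem_ball_self hρ0)).hasDerivAt.eventually_ne hd0).frequently.filter_mono
        nhdsWithin_le_nhds
  by_contra hcon
  push Not at hcon
  obtain ⟨p, hp, hp'⟩ := homit (h a)
  apply hp'
  have h3 : 3 * r / 4 - dist a c = 2 * ρ := by rw [hρ]; ring
  have hp2 : p ∈ ball (h a) (d * ρ / 12 / 2) := by
    refine ball_subset_ball ?_ hp
    rw [h3] at hcon; nlinarith
  exact image_mono ((closedBall_subset_ball (by linarith)).trans hball') (himg hp2)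

theorem norm_cosh_le (z : ℂ) : ‖Complex.cosh z‖ ≤ Real.cosh z.re := by
  rw [Complex.cosh, Real.cosh_eq, norm_div]
  have := norm_add_le (Complex.exp z) (Complex.exp (-z))
  simp only [Complex.norm_exp, Complex.neg_re] at this
  simp only [Complex.norm_ofNat]
  linarith

theorem abs_re_le_norm_cosh (z : ℂ) : |z.re| ≤ ‖Complex.cosh z‖ := by
  have key : Real.sinh |z.re| ≤ ‖Complex.cosh z‖ := by
    have h1 := abs_norm_sub_norm_le (Complex.exp z) (-Complex.exp (-z))
    rw [sub_neg_eq_add, norm_neg] at h1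
    simp only [Complex.norm_exp, Complex.neg_re] at h1
    rw [Complex.cosh, norm_div, Complex.norm_ofNat, ← Real.abs_sinh, Real.sinh_eq, abs_div,
      abs_of_pos (two_pos : (0 : ℝ) < 2)]
    linarith
  exact (Real.self_le_sinh_iff.2 (abs_nonneg _)).trans key

theorem two_mul_cosh_le_cosh_add_two {a : ℝ} (ha : 0 ≤ a) :
    2 * Real.cosh a < Real.cosh (a + 2) := by
  rw [Real.cosh_add]
  have h1 : 2 < Real.cosh 2 := by
    rw [Real.cosh_eq]
    have h2 := Real.quadratic_le_exp_of_nonneg (x := 2) (by norm_num)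
    have := Real.exp_pos (-2)
    linarith
  have h3 : 0 ≤ Real.sinh a * Real.sinh 2 :=
    mul_nonneg (Real.sinh_nonneg_iff.2 ha) (Real.sinh_nonneg_iff.2 (by norm_num))
  nlinarith [Real.cosh_pos a]

theorem exists_nat_cosh_near {x : ℝ} (hx : 0 ≤ x) :
    ∃ y : ℝ, |y - x| ≤ 2 ∧ ∃ n : ℕ, Real.cosh y = n := by
  set n := ⌊Real.cosh x⌋₊ with hn
  have hn1 : 1 ≤ n := Nat.le_floor (by simp [Real.one_le_cosh x])
  have hnx : (n : ℝ) ≤ Real.cosh x := Nat.floor_le (Real.cosh_pos x).le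
  obtain ⟨y, hy, hyn⟩ := intermediate_value_Icc hx (Real.continuous_cosh.continuousOn)
    (show (n : ℝ) ∈ Icc (Real.cosh 0) (Real.cosh x) by
      rw [Real.cosh_zero]; exact ⟨by exact_mod_cast hn1, hnx⟩)
  refine ⟨y, ?_, n, hyn⟩
  have : x ≤ y + 2 := by
    by_contra hlt
    push Not at hlt
    have h1 := two_mul_cosh_le_cosh_add_two hy.1
    have h2 : Real.cosh (y + 2) < Real.cosh x :=
      Real.cosh_strictMonoOn (show 0 ≤ y + 2 by linarith [hy.1]) hx hlt
    have h3 := Nat.lt_floor_add_one (Real.cosh x)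
    rw [← hn] at h3
    have : (1 : ℝ) ≤ n := by exact_mod_cast hn1
    rw [hyn] at h1
    linarith
  rw [abs_le]; constructor <;> linarith [hy.2]

/-- The set `cosh⁻¹(ℤ)` contains the points `y + π i m` with `cosh y ∈ ℕ` and `m ∈ ℤ`. -/
theorem exists_cosh_eq_int_near (w : ℂ) : ∃ p ∈ ball w 4, ∃ n : ℤ, Complex.cosh p = n := by
  obtain ⟨y, hy, n, hyn⟩ : ∃ y : ℝ, |y - w.re| ≤ 2 ∧ ∃ n : ℕ, Real.cosh y = n := by
    rcases le_total 0 w.re with h | h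
    · exact exists_nat_cosh_near h
    · obtain ⟨y, hy, n, hn⟩ := exists_nat_cosh_near (neg_nonneg.2 h)
      refine ⟨-y, ?_, n, by rwa [Real.cosh_neg]⟩
      rw [← abs_neg]; convert hy using 2; ring
  set m : ℤ := round (w.im / Real.pi) with hm
  refine ⟨y + m * Real.pi * Complex.I, ?_, ?_⟩
  · rw [mem_ball, dist_eq_norm]
    have h1 := Complex.norm_le_abs_re_add_abs_im (y + m * Real.pi * Complex.I - w)
    have hre : (y + m * Real.pi * Complex.I - w).re = y - w.re := by simp
    have him : (y + m * Real.pi * Complex.I - w).im = m * Real.pi - w.im := by simp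
    rw [hre, him] at h1
    have h2 := abs_sub_round (w.im / Real.pi)
    rw [← hm] at h2
    have hpi := Real.pi_pos
    have h3 : |m * Real.pi - w.im| ≤ 1 / 2 * Real.pi := by
      have : m * Real.pi - w.im = -((w.im / Real.pi - m) * Real.pi) := by field_simp; ring
      rw [this, abs_neg, abs_mul, abs_of_pos hpi]
      gcongr
    have := Real.pi_lt_d2
    linarith
  · obtain ⟨k, hk⟩ : ∃ k : ℤ, Complex.cosh (m * Real.pi * Complex.I) = k := by
      have h1 := Complex.sin_sq_add_cos_sq (m * Real.pi)
      rw [Complex.sin_int_mul_pi, zero_pow two_ne_zero, zero_add] at h1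
      rw [sq_eq_one_iff] at h1
      rw [Complex.cosh_mul_I]
      rcases h1 with h | h
      · exact ⟨1, by simp [h]⟩
      · exact ⟨-1, by simp [h]⟩
    refine ⟨n * k, ?_⟩
    rw [Complex.cosh_add, hk, Complex.sinh_mul_I, Complex.sin_int_mul_pi, ← Complex.ofReal_cosh,
      hyn]
    simp

/-- Schottky's theorem for functions omitting all integers. -/
theorem norm_le_cosh_of_omits_int {c : ℂ} {r : ℝ} {φ : ℂ → ℂ} (hr : 0 < r)
    (hφ : DifferentiableOn ℂ φ (ball c r)) (homit : ∀ z ∈ ball c r, ∀ n : ℤ, φ z ≠ n) :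
    ∀ z ∈ closedBall c (r / 2), ‖φ z‖ ≤ Real.cosh (‖φ c‖ + 384) := by
  -- `exp (L / 2)` is a branch of `√(φ² - 1)`; then `l = log (φ + √(φ² - 1))` is a branch of
  -- `arcosh φ`, since `(φ + √(φ² - 1)) (φ - √(φ² - 1)) = 1`.
  obtain ⟨L, hL, hLexp⟩ := exists_log_on_ball (h := fun z => φ z ^ 2 - 1) (by fun_prop)
    (by
      intro z hz h0
      have : (φ z - 1) * (φ z + 1) = 0 := by linear_combination h0
      rcases mul_eq_zero.1 this with h | h
      · exact homit z hz 1 (by push_cast; linear_combination h)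
      · exact homit z hz (-1) (by push_cast; linear_combination h))
  have hq : ∀ z ∈ ball c r, Complex.exp (L z / 2) ^ 2 = φ z ^ 2 - 1 := by
    intro z hz
    rw [← hLexp z hz, ← Complex.exp_nat_mul]; congr 1; push_cast; ring
  obtain ⟨l, hl, hlexp⟩ := exists_log_on_ball (h := fun z => φ z + Complex.exp (L z / 2))
    (by fun_prop)
    (by
      intro z hz h0
      have h1 : (φ z + Complex.exp (L z / 2)) * (φ z - Complex.exp (L z / 2)) = 1 := by
        linear_combination -hq z hz
      rw [h0] at h1; simp at h1)
  have hcosh : ∀ z ∈ ball c r, Complex.cosh (l z) = φ z := by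
    intro z hz
    have h1 : Complex.exp (l z) * Complex.exp (-(l z)) = 1 := by
      rw [← Complex.exp_add]; simp
    have h2 : Complex.exp (l z) * (φ z - Complex.exp (L z / 2)) = 1 := by
      rw [hlexp z hz]; linear_combination -hq z hz
    have h3 := mul_left_cancel₀ (Complex.exp_ne_zero _) (h1.trans h2.symm)
    rw [Complex.cosh, h3, hlexp z hz]; ring
  have hder := norm_deriv_le_of_image_contains_no_ball hr hl (B := 4) (by
    intro w
    obtain ⟨p, hp, n, hn⟩ := exists_cosh_eq_int_near w
    refine ⟨p, hp, ?_⟩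
    rintro ⟨z, hz, rfl⟩
    exact homit z hz n (by rw [← hcosh z hz, hn]))
  have hsub : closedBall c (r / 2) ⊆ ball c r := closedBall_subset_ball (by linarith)
  have hc : c ∈ closedBall c (r / 2) := mem_closedBall_self (by linarith)
  intro z hz
  have h1 : ‖l z - l c‖ ≤ 192 * 4 / r * ‖z - c‖ :=
    (convex_closedBall c (r / 2)).norm_image_sub_le_of_norm_deriv_le
      (fun x hx => hl.differentiableAt (isOpen_ball.mem_nhds (hsub hx))) hder hc hz
  have h2 : ‖l z - l c‖ ≤ 384 := by
    refine h1.trans ?_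
    rw [mem_closedBall, dist_eq_norm] at hz
    calc 192 * 4 / r * ‖z - c‖ ≤ 192 * 4 / r * (r / 2) := by gcongr
      _ = 384 := by field_simp; norm_num
  have h3 : |(l z).re| ≤ ‖φ c‖ + 384 := by
    have h4 := abs_re_le_norm_cosh (l c)
    rw [hcosh c (hsub hc)] at h4
    have h5 := (Complex.abs_re_le_norm (l z - l c)).trans h2
    rw [Complex.sub_re] at h5
    have := abs_sub_abs_le_abs_sub (l z).re (l c).re
    linarith
  rw [← hcosh z (hsub hz)]
  refine (norm_cosh_le _).trans ?_
  rw [Real.cosh_le_cosh]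
  refine h3.trans (le_abs_self _)

/-! ### Families of functions with disjoint translates -/

/-- Harnack's inequality for positive real parts of holomorphic functions. -/
theorem re_ge_of_re_pos {c : ℂ} {r : ℝ} {v : ℂ → ℂ} (hv : DifferentiableOn ℂ v (ball c r))
    (hpos : ∀ z ∈ ball c r, 0 < (v z).re) :
    ∀ z ∈ ball c (r / 2), 3 / 16 * (v c).re ≤ (v z).re := by
  intro z hz
  have hr : 0 < r := by have := pos_of_mem_ball hz; linarith
  have hzr : z ∈ ball c r := ball_subset_ball (by linarith) hz
  have hvc := hpos c (mem_ball_self hr)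
  set a := v c with ha
  have hne : ∀ x ∈ ball c r, v x + (starRingEnd ℂ) a ≠ 0 := by
    intro x hx h0
    have := congrArg Complex.re h0
    simp at this
    linarith [hpos x hx]
  have hid : ∀ x, ‖v x + (starRingEnd ℂ) a‖ ^ 2 - ‖v x - a‖ ^ 2 = 4 * (v x).re * a.re := by
    intro x
    rw [← Complex.normSq_eq_norm_sq, ← Complex.normSq_eq_norm_sq, Complex.normSq_apply,
      Complex.normSq_apply]
    simp; ring
  -- The Cayley transform maps the right half-plane to the unit disc and `v c` to `0`.
  set φ : ℂ → ℂ := fun x => (v x - a) / (v x + (starRingEnd ℂ) a) with hφ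
  have hφc : φ c = 0 := by simp [hφ, ← ha]
  have hφd : DifferentiableOn ℂ φ (ball c r) :=
    (hv.sub_const _).div (hv.add_const _) hne
  have hmaps : MapsTo φ (ball c r) (closedBall (φ c) 1) := by
    intro x hx
    rw [hφc, mem_closedBall, dist_zero_right, norm_div]
    apply div_le_one_of_le₀ _ (norm_nonneg _)
    have h7 := hid x
    have h8 := mul_pos (hpos x hx) hvc
    exact le_of_sq_le_sq (by nlinarith) (norm_nonneg _)
  have h1 := Complex.dist_le_div_mul_dist_of_mapsTo_ball hφd hmaps hzr
  rw [hφc, dist_zero_right, norm_div] at h1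
  rw [mem_ball] at hz
  have h2 : ‖v z - a‖ / ‖v z + (starRingEnd ℂ) a‖ ≤ 1 / 2 := by
    refine h1.trans ?_
    rw [div_mul_eq_mul_div, one_mul, div_le_iff₀ hr]; linarith
  rw [div_le_iff₀ (norm_pos_iff.2 (hne z hzr))] at h2
  have h3 : a.re ≤ ‖v z + (starRingEnd ℂ) a‖ := by
    refine le_trans ?_ (Complex.re_le_norm _)
    simp; exact (hpos z hzr).le
  have h4 := hid z
  have h5 := norm_nonneg (v z - a)
  have h6 : 3 / 4 * a.re ^ 2 ≤ 4 * (v z).re * a.re := by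
    rw [← h4]; nlinarith
  nlinarith

/-- Harnack's inequality for `log (M / |u|)`: a bounded function without zeros that is small at the
centre of a ball is small on the half-size ball. -/
theorem norm_le_of_ne_zero_of_norm_lt {c : ℂ} {r M : ℝ} {u : ℂ → ℂ}
    (hu : DifferentiableOn ℂ u (ball c r)) (h0 : ∀ z ∈ ball c r, u z ≠ 0)
    (hM : ∀ z ∈ ball c r, ‖u z‖ < M) :
    ∀ z ∈ ball c (r / 2), ‖u z‖ ≤ M * (‖u c‖ / M) ^ (3 / 16 : ℝ) := by
  intro z hz
  have hr : 0 < r := by have := pos_of_mem_ball hz; linarith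
  have hzr : z ∈ ball c r := ball_subset_ball (by linarith) hz
  have hM0 : 0 < M := (norm_nonneg _).trans_lt (hM z hzr)
  obtain ⟨L, hL, hexp⟩ := exists_log_on_ball hu h0
  have hre : ∀ x ∈ ball c r, Real.exp (-((Real.log M : ℂ) - L x).re) = ‖u x‖ / M := by
    intro x hx
    rw [← hexp x hx, Complex.norm_exp, Complex.sub_re, Complex.ofReal_re, neg_sub, Real.exp_sub,
      Real.exp_log hM0]
  have h1 := re_ge_of_re_pos (v := fun x => (Real.log M : ℂ) - L x) (hL.const_sub _) (by
    intro x hx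
    have h2 : Real.exp (-((Real.log M : ℂ) - L x).re) < 1 := by
      rw [hre x hx, div_lt_one hM0]; exact hM x hx
    rw [Real.exp_lt_one_iff] at h2
    linarith) z hz
  rw [← hre c (mem_ball_self hr), ← Real.exp_mul, ← div_le_iff₀' hM0, ← hre z hzr]
  apply Real.exp_le_exp.2
  linarith

/-- If holomorphic functions `f t` on a ball, `t > 0`, have pairwise disjoint graphs modulo `2πi` and
converge at the centre as `t → 0`, then they converge uniformly on a smaller concentric ball. -/
theorem exists_tendstoUniformlyOn_of_disjoint_translates {f : ℝ → ℂ → ℂ} {c z₀ : ℂ} {r : ℝ}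
    (hr : 0 < r) (hf : ∀ t, 0 < t → DifferentiableOn ℂ (f t) (ball c r))
    (hdisj : ∀ t, 0 < t → ∀ t', 0 < t' → t ≠ t' → ∀ z ∈ ball c r, ∀ k : ℤ,
      f t z ≠ f t' z + k * (2 * Real.pi * Complex.I))
    (hlim : Tendsto (fun t => f t c) (𝓝[>] 0) (𝓝 z₀)) :
    ∃ z : ℂ → ℂ, TendstoUniformlyOn f z (𝓝[>] 0) (ball c (r / 4)) := by
  have hpi : (2 * Real.pi * Complex.I : ℂ) ≠ 0 := Complex.two_pi_I_ne_zero
  set φ : ℝ → ℂ → ℂ := fun t z => (f t z - f 1 z) / (2 * Real.pi * Complex.I) with hφ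
  have hcb : ball c (r / 2) ⊆ closedBall c (r / 2) := ball_subset_closedBall
  have hcr : ball c (r / 2) ⊆ ball c r := ball_subset_ball (by linarith)
  obtain ⟨A, hA⟩ : ∃ A, ∀ᶠ t in 𝓝[>] (0 : ℝ), ‖φ t c‖ ≤ A := by
    have h1 : Tendsto (fun t => φ t c) (𝓝[>] 0) (𝓝 ((z₀ - f 1 c) / (2 * Real.pi * Complex.I))) :=
      (hlim.sub_const _).div_const _
    exact ⟨_, (h1.norm.eventually (gt_mem_nhds (lt_add_one _))).mono fun _ h => h.le⟩
  set C := Real.cosh (A + 384) with hC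
  have hCpos : 0 < C := Real.cosh_pos _
  have hbound : ∀ᶠ t in 𝓝[>] (0 : ℝ), 0 < t ∧ ∀ z ∈ ball c (r / 2), ‖φ t z‖ ≤ C := by
    have h1 : ∀ᶠ t in 𝓝[>] (0 : ℝ), t < 1 := nhdsWithin_le_nhds (gt_mem_nhds one_pos)
    filter_upwards [hA, h1, self_mem_nhdsWithin] with t ht ht1 ht0
    refine ⟨ht0, fun z hz => ?_⟩
    refine (norm_le_cosh_of_omits_int (φ := φ t) hr
      (((hf t ht0).sub (hf 1 one_pos)).div_const _) ?_ z (hcb hz)).trans ?_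
    · intro x hx k hk
      apply hdisj t ht0 1 one_pos ht1.ne x hx k
      simp only [hφ] at hk
      rw [div_eq_iff hpi] at hk
      linear_combination hk
    · rw [hC, Real.cosh_le_cosh]
      exact (abs_of_nonneg (by positivity : 0 ≤ ‖φ t c‖ + 384)).le.trans
        ((by linarith : ‖φ t c‖ + 384 ≤ A + 384).trans (le_abs_self _))
  set M : ℝ := 2 * Real.pi * (2 * C) + 1 with hM
  have hMpos : 0 < M := by have := Real.pi_pos; positivity
  have hdiff : ∀ t t', (0 < t ∧ ∀ z ∈ ball c (r / 2), ‖φ t z‖ ≤ C) →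
      (0 < t' ∧ ∀ z ∈ ball c (r / 2), ‖φ t' z‖ ≤ C) → ∀ z ∈ ball c (r / 4),
      ‖f t z - f t' z‖ ≤ M * (‖f t c - f t' c‖ / M) ^ (3 / 16 : ℝ) := by
    intro t t' ht ht' z hz
    rcases eq_or_ne t t' with rfl | hne
    · rw [sub_self, norm_zero]; positivity
    refine norm_le_of_ne_zero_of_norm_lt (u := fun z => f t z - f t' z) (r := r / 2)
      (((hf t ht.1).sub (hf t' ht'.1)).mono hcr) ?_ ?_ z (by convert hz using 2; ring)
    · intro x hx h0
      exact hdisj t ht.1 t' ht'.1 hne x (hcr hx) 0 (by simpa using sub_eq_zero.1 h0)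
    · intro x hx
      have h1 : f t x - f t' x = (2 * Real.pi * Complex.I) * (φ t x - φ t' x) := by
        simp only [hφ]; field_simp; ring
      have h2 := (norm_sub_le (φ t x) (φ t' x)).trans (add_le_add (ht.2 x hx) (ht'.2 x hx))
      have h3 : ‖(2 * Real.pi * Complex.I : ℂ)‖ = 2 * Real.pi := by
        simp [abs_of_pos Real.pi_pos]
      rw [h1, norm_mul, h3, hM]
      have := Real.pi_pos
      nlinarith
  have hcauchy : UniformCauchySeqOn f (𝓝[>] 0) (ball c (r / 4)) := by
    intro V hV
    obtain ⟨ε, hε, hεV⟩ := Metric.mem_uniformity_dist.1 hV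
    have h1 : Tendsto (fun p : ℝ × ℝ => M * (‖f p.1 c - f p.2 c‖ / M) ^ (3 / 16 : ℝ))
        (𝓝[>] 0 ×ˢ 𝓝[>] 0) (𝓝 (M * (‖z₀ - z₀‖ / M) ^ (3 / 16 : ℝ))) := by
      have h2 := (((hlim.comp tendsto_fst).sub (hlim.comp tendsto_snd)).norm.div_const M)
      exact (h2.rpow_const (Or.inr (by norm_num))).const_mul M
    rw [sub_self, norm_zero, zero_div, Real.zero_rpow (by norm_num), mul_zero] at h1
    filter_upwards [h1.eventually (gt_mem_nhds hε), hbound.prod_mk hbound] with p hp hb z hz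
    apply hεV
    rw [dist_eq_norm]
    exact (hdiff p.1 p.2 hb.1 hb.2 z hz).trans_lt hp
  have hpt : ∀ z ∈ ball c (r / 4), ∃ w, Tendsto (fun t => f t z) (𝓝[>] 0) (𝓝 w) :=
    fun z hz => CompleteSpace.complete (hcauchy.cauchy_map hz)
  choose! z hz using hpt
  exact ⟨z, hcauchy.tendstoUniformlyOn_of_tendsto hz⟩

/-- Convergence at one point spreads over a domain: the radius in
`exists_tendstoUniformlyOn_of_disjoint_translates` depends only on the ball, so the set of points of
convergence is relatively closed as well as open. -/
theorem exists_differentiableOn_tendsto_of_disjoint_translates {f : ℝ → ℂ → ℂ} {W : Set ℂ}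
    (hWo : IsOpen W) (hWc : IsPreconnected W)
    (hf : ∀ t, 0 < t → DifferentiableOn ℂ (f t) W)
    (hdisj : ∀ t, 0 < t → ∀ t', 0 < t' → t ≠ t' → ∀ z ∈ W, ∀ k : ℤ,
      f t z ≠ f t' z + k * (2 * Real.pi * Complex.I))
    {κ₀ z₀ : ℂ} (hκ₀ : κ₀ ∈ W) (hlim : Tendsto (fun t => f t κ₀) (𝓝[>] 0) (𝓝 z₀)) :
    ∃ z : ℂ → ℂ, DifferentiableOn ℂ z W ∧ ∀ κ ∈ W, Tendsto (fun t => f t κ) (𝓝[>] 0) (𝓝 (z κ)) := by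
  have hloc : ∀ c r, 0 < r → ball c r ⊆ W → (∃ w, Tendsto (fun t => f t c) (𝓝[>] 0) (𝓝 w)) →
      ∃ z : ℂ → ℂ, TendstoUniformlyOn f z (𝓝[>] 0) (ball c (r / 4)) := by
    rintro c r hr hsub ⟨w, hw⟩
    exact exists_tendstoUniformlyOn_of_disjoint_translates hr (fun t ht => (hf t ht).mono hsub)
      (fun t ht t' ht' hne z hz => hdisj t ht t' ht' hne z (hsub hz)) hw
  set S : Set ℂ := {κ | κ ∈ W ∧ ∃ w, Tendsto (fun t => f t κ) (𝓝[>] 0) (𝓝 w)} with hS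
  have hSo : IsOpen S := by
    rw [Metric.isOpen_iff]
    rintro x ⟨hxW, hx⟩
    obtain ⟨r, hr, hsub⟩ := Metric.isOpen_iff.1 hWo x hxW
    obtain ⟨z, hz⟩ := hloc x r hr hsub hx
    exact ⟨r / 4, by positivity, fun y hy =>
      ⟨hsub (ball_subset_ball (by linarith) hy), z y, hz.tendsto_at hy⟩⟩
  have hWS : W ⊆ S := by
    refine hWc.subset_of_closure_inter_subset hSo ⟨κ₀, hκ₀, hκ₀, z₀, hlim⟩ ?_
    rintro x ⟨hxS, hxW⟩
    obtain ⟨r, hr, hsub⟩ := Metric.isOpen_iff.1 hWo x hxW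
    obtain ⟨y, hy, hxy⟩ := Metric.mem_closure_iff.1 hxS (r / 8) (by positivity)
    obtain ⟨z, hz⟩ := hloc y (r / 2) (by positivity)
      ((ball_subset_ball' (by rw [dist_comm y x]; linarith)).trans hsub) hy.2
    exact ⟨hxW, z x, hz.tendsto_at (by rw [mem_ball]; linarith)⟩
  have hlimW : ∀ κ ∈ W, ∃ w, Tendsto (fun t => f t κ) (𝓝[>] 0) (𝓝 w) := fun κ hκ => (hWS hκ).2
  choose! z hz using hlimW
  refine ⟨z, fun x hx => ?_, hz⟩
  obtain ⟨r, hr, hsub⟩ := Metric.isOpen_iff.1 hWo x hx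
  obtain ⟨z', hz'⟩ := hloc x r hr hsub ⟨_, hz x hx⟩
  have hsub4 : ball x (r / 4) ⊆ W := (ball_subset_ball (by linarith)).trans hsub
  have hd : DifferentiableOn ℂ z' (ball x (r / 4)) :=
    hz'.tendstoLocallyUniformlyOn.differentiableOn
      (by filter_upwards [self_mem_nhdsWithin] with t ht using (hf t ht).mono hsub4) isOpen_ball
  have heq : EqOn z z' (ball x (r / 4)) := fun y hy =>
    tendsto_nhds_unique (hz y (hsub4 hy)) (hz'.tendsto_at hy)
  exact ((hd.congr heq).differentiableAt (ball_mem_nhds x (by positivity))).differentiableWithinAt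

/-! ### The growth model -/

theorem F_pos {t : ℝ} (ht : 0 < t) : 0 < F t := by
  unfold F; have := Real.add_one_lt_exp ht.ne'; linarith

theorem strictMono_F : StrictMono F := fun a b h => by
  unfold F; have := Real.exp_lt_exp.2 h; linarith

theorem continuous_F : Continuous F := by unfold F; fun_prop

theorem F_iterate_pos {t : ℝ} (ht : 0 < t) (n : ℕ) : 0 < F^[n] t := by
  induction n generalizing t with
  | zero => simpa
  | succ n ih => rw [Function.iterate_succ_apply]; exact ih (F_pos ht)

theorem le_F (t : ℝ) : t ≤ F t := by
  unfold F; have := Real.add_one_le_exp t; linarith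

theorem le_F_iterate (t : ℝ) (n : ℕ) : t ≤ F^[n] t := by
  induction n generalizing t with
  | zero => simp
  | succ n ih => rw [Function.iterate_succ_apply]; exact (le_F t).trans (ih _)

/-- `F' ≥ 1 + a` on `[a, ∞)`, so `F` expands distances there. -/
theorem F_sub_ge {a t : ℝ} (hat : a ≤ t) : (1 + a) * (t - a) ≤ F t - F a := by
  unfold F
  have h1 : Real.exp t = Real.exp a * Real.exp (t - a) := by rw [← Real.exp_add]; ring_nf
  have h2 := Real.add_one_le_exp (t - a)
  have h3 := Real.add_one_le_exp a
  have h4 := Real.exp_pos a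
  nlinarith

theorem F_iterate_sub_ge {a t : ℝ} (ha : 0 ≤ a) (hat : a ≤ t) (n : ℕ) :
    (1 + a) ^ n * (t - a) ≤ F^[n] t - F^[n] a := by
  induction n with
  | zero => simp
  | succ n ih =>
    rw [Function.iterate_succ_apply', Function.iterate_succ_apply']
    have h1 := F_sub_ge ((strictMono_F.iterate n).monotone hat)
    have h2 := le_F_iterate a n
    have h3 : 0 ≤ t - a := sub_nonneg.2 hat
    have h4 : 0 ≤ (1 + a) ^ n * (t - a) := by positivity
    calc (1 + a) ^ (n + 1) * (t - a) = (1 + a) * ((1 + a) ^ n * (t - a)) := by ring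
      _ ≤ (1 + F^[n] a) * (F^[n] t - F^[n] a) := by gcongr; linarith
      _ ≤ _ := h1

theorem tendsto_F_iterate_sub {a t : ℝ} (ha : 0 < a) (hat : a < t) :
    Tendsto (fun n => F^[n] t - F^[n] a) atTop atTop :=
  tendsto_atTop_mono (F_iterate_sub_ge ha.le hat.le)
    ((tendsto_pow_atTop_atTop_of_one_lt (by linarith)).atTop_mul_const (sub_pos.2 hat))

theorem tendsto_F_iterate {t : ℝ} (ht : 0 < t) : Tendsto (fun n => F^[n] t) atTop atTop := by
  refine tendsto_atTop_mono (fun n => ?_) (tendsto_F_iterate_sub (half_pos ht) (half_lt_self ht))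
  have := F_iterate_pos (half_pos ht) n
  linarith

/-! ### The exponential map on right half-planes -/

theorem continuous_E (κ : ℂ) : Continuous (E κ) := by unfold E; fun_prop

theorem E_re (κ z : ℂ) : (E κ z).re = Real.exp z.re * Real.cos z.im + κ.re := by
  simp [E, Complex.exp_re]

theorem shift_iterate_apply (s : Address) (n k : ℕ) : (shift^[n] s) k = s (k + n) := by
  induction n generalizing s with
  | zero => rfl
  | succ n ih => rw [Function.iterate_succ_apply, ih]; simp only [shift]; congr 1

/-- Every odd multiple of `π` is sent by `E κ` to a point left of `κ`. -/
theorem E_re_le_of_im {κ z : ℂ} {m : ℤ} (h : z.im = (2 * m + 1) * Real.pi) :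
    (E κ z).re ≤ κ.re := by
  have hc : Real.cos z.im = -1 := by
    rw [h, show (2 * (m : ℝ) + 1) * Real.pi = Real.pi + m * (2 * Real.pi) by ring,
      Real.cos_add_int_mul_two_pi, Real.cos_pi]
  rw [E_re, hc]
  have := Real.exp_pos z.re
  linarith

/-- Logarithm is a contraction by the factor `1/2` on `{Re ≥ 2}`. -/
theorem norm_log_sub_log_le {z w : ℂ} (hz : 2 ≤ z.re) (hw : 2 ≤ w.re) :
    ‖Complex.log z - Complex.log w‖ ≤ 1 / 2 * ‖z - w‖ := by
  have hconv : Convex ℝ {x : ℂ | 2 ≤ x.re} := convex_halfSpace_re_ge 2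
  have hpos : ∀ x ∈ {x : ℂ | 2 ≤ x.re}, 0 < x.re := fun x hx => by
    have : 2 ≤ x.re := hx
    linarith
  refine hconv.norm_image_sub_le_of_norm_hasDerivWithin_le (f' := fun x => x⁻¹)
    (fun x hx => (Complex.hasDerivAt_log (Or.inl (hpos x hx))).hasDerivWithinAt)
    (fun x hx => ?_) hw hz
  rw [norm_inv, one_div]
  apply inv_anti₀ two_pos
  exact le_trans hx (Complex.re_le_norm x)

theorem im_mem_Ioo_of_sub {x : ℝ} {m : ℤ}
    (h : x ∈ Ioo ((2 * (m : ℝ) - 1) * Real.pi) ((2 * (m : ℝ) + 1) * Real.pi)) :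
    x - 2 * m * Real.pi ∈ Ioo (-Real.pi) Real.pi := by
  constructor <;> nlinarith [h.1, h.2]

/-- In the strip of index `m`, `E κ` is inverted by a translate of the principal logarithm. -/
theorem log_E_sub {κ z : ℂ} {m : ℤ}
    (h : z.im ∈ Ioo ((2 * (m : ℝ) - 1) * Real.pi) ((2 * (m : ℝ) + 1) * Real.pi)) :
    Complex.log (E κ z - κ) = z - 2 * Real.pi * Complex.I * m := by
  have h1 := im_mem_Ioo_of_sub h
  have him : (z - 2 * Real.pi * Complex.I * m).im = z.im - 2 * m * Real.pi := by
    simp; ring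
  have h2 : E κ z - κ = Complex.exp (z - 2 * Real.pi * Complex.I * m) := by
    rw [Complex.exp_sub, mul_comm (2 * Real.pi * Complex.I : ℂ), Complex.exp_int_mul_two_pi_mul_I]
    simp [E]
  rw [h2, Complex.log_exp]
  · rw [him]; exact h1.1
  · rw [him]; exact h1.2.le

/-- `E κ` expands distances within a strip at points whose images lie far to the right. -/
theorem norm_sub_le_half_norm_E_sub {κ z w : ℂ} {m : ℤ}
    (hz : z.im ∈ Ioo ((2 * (m : ℝ) - 1) * Real.pi) ((2 * (m : ℝ) + 1) * Real.pi))
    (hw : w.im ∈ Ioo ((2 * (m : ℝ) - 1) * Real.pi) ((2 * (m : ℝ) + 1) * Real.pi))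
    (hEz : κ.re + 2 ≤ (E κ z).re) (hEw : κ.re + 2 ≤ (E κ w).re) :
    ‖z - w‖ ≤ 1 / 2 * ‖E κ z - E κ w‖ := by
  have h1 := norm_log_sub_log_le (z := E κ z - κ) (w := E κ w - κ)
    (by rw [Complex.sub_re]; linarith) (by rw [Complex.sub_re]; linarith)
  rw [log_E_sub hz, log_E_sub hw] at h1
  convert h1 using 2 <;> ring_nf

theorem isLocallyInjective_exp : IsLocallyInjective Complex.exp := by
  intro x
  refine ⟨ball x 1, isOpen_ball, mem_ball_self one_pos, fun z hz w hw h => ?_⟩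
  have h1 : ‖z - w‖ < 2 := by
    rw [← dist_eq_norm]
    have := dist_triangle_right z w x
    rw [mem_ball] at hz hw
    linarith
  have h2 := abs_lt.1 ((Complex.abs_im_le_norm _).trans_lt h1)
  have h3 := Real.pi_gt_three
  have h4 := Complex.log_exp (x := z - w) (by linarith) (by linarith)
  rw [Complex.exp_sub, h, div_self (Complex.exp_ne_zero w), Complex.log_one] at h4
  exact sub_eq_zero.1 h4.symm

/-- Uniqueness of continuous lifts under `exp`. -/
theorem eqOn_of_exp_eqOn {X : Type*} [TopologicalSpace X] {A : Set X} {u v : X → ℂ}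
    (hA : IsPreconnected A) (hu : ContinuousOn u A) (hv : ContinuousOn v A)
    (h : ∀ x ∈ A, Complex.exp (u x) = Complex.exp (v x)) {x₀ : X} (hx₀ : x₀ ∈ A)
    (h₀ : u x₀ = v x₀) : EqOn u v A :=
  (T2Space.isSeparatedMap Complex.exp).eqOn_of_comp_eqOn isLocallyInjective_exp hA hu hv h hx₀ h₀

/-! ### Uniqueness and maximality of rays -/

namespace IsRayCurve
variable {κ : ℂ} {s : Address} {a b : ℝ} {g h : ℝ → ℂ}

theorem continuousOn_iterate (hg : IsRayCurve κ s a g) (n : ℕ) :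
    ContinuousOn (fun t => (E κ)^[n] (g t)) (Ioi a) :=
  ((continuous_E κ).iterate n).comp_continuousOn hg.cont

theorem exists_forall_re_ge (hg : IsRayCurve κ s a g) {t₀ : ℝ} (ht₀ : a < t₀) (ρ : ℝ) :
    ∃ N : ℕ, ∀ n, N ≤ n → ∀ t, t₀ ≤ t → ρ < ((E κ)^[n] (g t)).re := by
  obtain ⟨R, hR⟩ := hg.asymptotics t₀ ht₀ 1 one_pos
  have h1 := tendsto_F_iterate (hg.nonneg.trans_lt ht₀)
  obtain ⟨N, hN⟩ := eventually_atTop.1 ((h1.eventually_gt_atTop (ρ + 1)).and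
    (tendsto_natCast_atTop_atTop.eventually_ge_atTop R))
  refine ⟨N, fun n hn t ht => ?_⟩
  have h2 := hN n hn
  have h3 := abs_lt.1 (hR n t ht (Or.inl h2.2))
  have h4 := (strictMono_F.iterate n).monotone ht
  linarith [h3.1, h2.1]

/-- Far to the right the orbit of a ray cannot leave its strip, because the boundary lines of the
strips are mapped to the far left. So the iterates of the ray have the address of the ray. -/
theorem exists_forall_im_mem (hg : IsRayCurve κ s a g) {t₀ : ℝ} (ht₀ : a < t₀) :
    ∃ N : ℕ, ∀ n, N ≤ n → ∀ t, t₀ ≤ t → κ.re + 2 ≤ ((E κ)^[n] (g t)).re ∧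
      ((E κ)^[n] (g t)).im ∈
        Ioo ((2 * (s n : ℝ) - 1) * Real.pi) ((2 * (s n : ℝ) + 1) * Real.pi) := by
  obtain ⟨N, hN⟩ := hg.exists_forall_re_ge ht₀ (κ.re + 2)
  refine ⟨N, fun n hn t ht => ⟨(hN n hn t ht).le, ?_⟩⟩
  obtain ⟨T, hT, hadd⟩ := hg.address
  set f : ℝ → ℝ := fun t => ((E κ)^[n] (g t)).im with hf
  have hfc : ContinuousOn f (Ici t₀) := Complex.continuous_im.comp_continuousOn
    ((hg.continuousOn_iterate n).mono (Ici_subset_Ioi.2 ht₀))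
  have hpre : IsPreconnected (f '' Ici t₀) := isPreconnected_Ici.image f hfc
  have havoid : ∀ m : ℤ, (2 * (m : ℝ) + 1) * Real.pi ∉ f '' Ici t₀ := by
    rintro m ⟨u, hu, hfu⟩
    have h1 := E_re_le_of_im (κ := κ) hfu
    rw [← Function.iterate_succ_apply' (E κ)] at h1
    have h2 := hN (n + 1) (by omega) u hu
    linarith
  have hbase : f (max t₀ T) ∈
      Ioo ((2 * (s n : ℝ) - 1) * Real.pi) ((2 * (s n : ℝ) + 1) * Real.pi) :=
    hadd _ (le_max_right _ _) n
  have hmem1 : f (max t₀ T) ∈ f '' Ici t₀ := mem_image_of_mem f (le_max_left t₀ T)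
  have hmem2 : f t ∈ f '' Ici t₀ := mem_image_of_mem f ht
  constructor
  · by_contra hle
    push Not at hle
    have h1 := hpre.Icc_subset hmem2 hmem1 ⟨hle, hbase.1.le⟩
    refine havoid (s n - 1) ?_
    convert h1 using 2
    push_cast; ring
  · by_contra hle
    push Not at hle
    exact havoid (s n) (hpre.Icc_subset hmem1 hmem2 ⟨hbase.2.le, hle⟩)

/-- Any two ray curves at the same address agree where both are defined. -/
theorem eqOn (hg : IsRayCurve κ s a g) (hh : IsRayCurve κ s b h) :
    EqOn g h (Ioi (max a b)) := by
  intro t₀ ht₀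
  have ha : a < t₀ := (le_max_left _ _).trans_lt ht₀
  have hb : b < t₀ := (le_max_right _ _).trans_lt ht₀
  obtain ⟨N₁, hN₁⟩ := hg.exists_forall_im_mem ha
  obtain ⟨N₂, hN₂⟩ := hh.exists_forall_im_mem hb
  obtain ⟨R₁, hR₁⟩ := hg.asymptotics t₀ ha 1 one_pos
  obtain ⟨R₂, hR₂⟩ := hh.asymptotics t₀ hb 1 one_pos
  obtain ⟨N₃, hN₃⟩ := exists_nat_ge (max R₁ R₂)
  set N := max (max N₁ N₂) N₃ with hN
  have hNN : N₁ ≤ N ∧ N₂ ≤ N ∧ N₃ ≤ N := by omega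
  have hpi := Real.pi_pos
  -- From time `N` on, the orbits stay within bounded distance and the map expands.
  have hbd : ∀ n, N ≤ n → ∀ t, t₀ ≤ t →
      ‖(E κ)^[n] (g t) - (E κ)^[n] (h t)‖ ≤ 2 + 2 * Real.pi := by
    intro n hn t ht
    refine (Complex.norm_le_abs_re_add_abs_im _).trans (add_le_add ?_ ?_)
    · have hn3 : max R₁ R₂ ≤ (n : ℝ) :=
        hN₃.trans (by exact_mod_cast hNN.2.2.trans hn)
      have h1 := abs_lt.1 (hR₁ n t ht (Or.inl ((le_max_left _ _).trans hn3)))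
      have h2 := abs_lt.1 (hR₂ n t ht (Or.inl ((le_max_right _ _).trans hn3)))
      rw [Complex.sub_re, abs_le]; constructor <;> linarith [h1.1, h1.2, h2.1, h2.2]
    · have h1 := (hN₁ n (hNN.1.trans hn) t ht).2
      have h2 := (hN₂ n (hNN.2.1.trans hn) t ht).2
      rw [Complex.sub_im, abs_le]; constructor <;> linarith [h1.1, h1.2, h2.1, h2.2]
  have hstep : ∀ n, N ≤ n → ∀ t, t₀ ≤ t → ‖(E κ)^[n] (g t) - (E κ)^[n] (h t)‖ ≤
      1 / 2 * ‖(E κ)^[n + 1] (g t) - (E κ)^[n + 1] (h t)‖ := by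
    intro n hn t ht
    have h1 := hN₁ n (hNN.1.trans hn) t ht
    have h2 := hN₂ n (hNN.2.1.trans hn) t ht
    have h3 := (hN₁ (n + 1) (by omega) t ht).1
    have h4 := (hN₂ (n + 1) (by omega) t ht).1
    rw [Function.iterate_succ_apply'] at h3 h4
    rw [Function.iterate_succ_apply', Function.iterate_succ_apply']
    exact norm_sub_le_half_norm_E_sub h1.2 h2.2 h3 h4
  have hpow : ∀ k n, N ≤ n → ∀ t, t₀ ≤ t → ‖(E κ)^[n] (g t) - (E κ)^[n] (h t)‖ ≤
      (1 / 2) ^ k * (2 + 2 * Real.pi) := by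
    intro k
    induction k with
    | zero => intro n hn t ht; simpa using hbd n hn t ht
    | succ k ih =>
      intro n hn t ht
      have h1 := hstep n hn t ht
      have h2 := ih (n + 1) (by omega) t ht
      rw [pow_succ]; linarith
  have hEqN : ∀ t, t₀ ≤ t → (E κ)^[N] (g t) = (E κ)^[N] (h t) := by
    intro t ht
    have h1 : Tendsto (fun k : ℕ => (1 / 2 : ℝ) ^ k * (2 + 2 * Real.pi)) atTop (𝓝 0) := by
      simpa using (tendsto_pow_atTop_nhds_zero_of_lt_one (by norm_num)
        (by norm_num : (1 / 2 : ℝ) < 1)).mul_const (2 + 2 * Real.pi)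
    have h2 := ge_of_tendsto' h1 fun k => hpow k N le_rfl t ht
    exact sub_eq_zero.1 (norm_le_zero_iff.1 h2)
  -- Pull the equality back: two continuous lifts under `exp` that agree for large `t` agree.
  obtain ⟨T₁, hT₁, hadd₁⟩ := hg.address
  obtain ⟨T₂, hT₂, hadd₂⟩ := hh.address
  set T := max t₀ (max T₁ T₂) with hT
  have hTT : t₀ ≤ T ∧ T₁ ≤ T ∧ T₂ ≤ T :=
    ⟨le_max_left _ _, (le_max_left _ _).trans (le_max_right _ _),
      (le_max_right _ _).trans (le_max_right _ _)⟩
  have hdown : ∀ j, j ≤ N → ∀ t, t₀ ≤ t → (E κ)^[N - j] (g t) = (E κ)^[N - j] (h t) := by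
    intro j
    induction j with
    | zero => intro _; simpa using hEqN
    | succ j ih =>
      intro hj t ht
      have ih' := ih (by omega)
      set n := N - (j + 1) with hn
      have hn1 : N - j = n + 1 := by omega
      rw [hn1] at ih'
      have hexp : ∀ u, t₀ ≤ u → E κ ((E κ)^[n] (g u)) = E κ ((E κ)^[n] (h u)) := by
        intro u hu
        have := ih' u hu
        rwa [Function.iterate_succ_apply', Function.iterate_succ_apply'] at this
      have hTeq : (E κ)^[n] (g T) = (E κ)^[n] (h T) := by
        have h1 := log_E_sub (κ := κ) (hadd₁ T hTT.2.1 n)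
        have h2 := log_E_sub (κ := κ) (hadd₂ T hTT.2.2 n)
        rw [hexp T hTT.1, h2] at h1
        exact (sub_left_inj.1 h1).symm
      exact eqOn_of_exp_eqOn isPreconnected_Ici
        ((hg.continuousOn_iterate n).mono (Ici_subset_Ioi.2 ha))
        ((hh.continuousOn_iterate n).mono (Ici_subset_Ioi.2 hb))
        (fun u hu => by simpa [E] using hexp u hu) hTT.1 hTeq ht
  have := hdown N le_rfl t₀ le_rfl
  simpa using this

theorem mono (hg : IsRayCurve κ s a g) (hab : a ≤ b) : IsRayCurve κ s b g where
  nonneg := hg.nonneg.trans hab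
  cont := hg.cont.mono (Ioi_subset_Ioi hab)
  escaping t ht := hg.escaping t (hab.trans_lt ht)
  address := by
    obtain ⟨T, -, h⟩ := hg.address
    exact ⟨max T (b + 1), (lt_add_one b).trans_le (le_max_right _ _),
      fun t ht => h t ((le_max_left _ _).trans ht)⟩
  asymptotics t₀ ht₀ := hg.asymptotics t₀ (hab.trans_lt ht₀)

theorem congr (hg : IsRayCurve κ s a g) (hgh : EqOn h g (Ioi a)) : IsRayCurve κ s a h where
  nonneg := hg.nonneg
  cont := hg.cont.congr hgh
  escaping t ht := by rw [hgh ht]; exact hg.escaping t ht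
  address := by
    obtain ⟨T, hT, h⟩ := hg.address
    exact ⟨T, hT, fun t ht => by rw [hgh (hT.trans_le ht)]; exact h t ht⟩
  asymptotics t₀ ht₀ ε hε := by
    obtain ⟨R, hR⟩ := hg.asymptotics t₀ ht₀ ε hε
    exact ⟨R, fun n t ht h => by rw [hgh (ht₀.trans_le ht)]; exact hR n t ht h⟩

/-- Ray curves at the same address glue to a maximal one. -/
theorem exists_isDynamicRay (hg : IsRayCurve κ s a g) :
    ∃ (b : ℝ) (h : ℝ → ℂ), IsDynamicRay κ s b h := by
  set S : Set ℝ := {c | ∃ h, IsRayCurve κ s c h} with hS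
  have hSne : S.Nonempty := ⟨a, g, hg⟩
  have hSbdd : BddBelow S := ⟨0, fun c ⟨h, hh⟩ => hh.nonneg⟩
  set b := sInf S with hb
  have hex : ∀ t, b < t → ∃ c h, c < t ∧ IsRayCurve κ s c h := fun t ht => by
    obtain ⟨c, ⟨h, hh⟩, hct⟩ := exists_lt_of_csInf_lt hSne ht
    exact ⟨c, h, hct, hh⟩
  choose! c h hc hh using hex
  set G : ℝ → ℂ := fun t => h t t with hG
  have hagree : ∀ c' h', IsRayCurve κ s c' h' → EqOn G h' (Ioi c') := by
    intro c' h' hh' t ht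
    have hbt : b < t := (csInf_le hSbdd ⟨h', hh'⟩).trans_lt ht
    exact (hh t hbt).eqOn hh' (max_lt (hc t hbt) ht)
  have hray : ∀ t, b < t → IsRayCurve κ s (c t) G := fun t ht =>
    (hh t ht).congr (hagree _ _ (hh t ht))
  refine ⟨b, G, ⟨?_, ?_, ?_, ?_, ?_⟩, fun c' h' hh' =>
    ⟨csInf_le hSbdd ⟨h', hh'⟩, (hagree c' h' hh').symm⟩⟩
  · exact le_csInf hSne fun c ⟨h, hh⟩ => hh.nonneg
  · exact fun t ht => ((hray t ht).cont.continuousAt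
      (isOpen_Ioi.mem_nhds (hc t ht))).continuousWithinAt
  · exact fun t ht => (hray t ht).escaping t (hc t ht)
  · obtain ⟨T, -, hT⟩ := (hray (b + 1) (lt_add_one b)).address
    exact ⟨max T (b + 1), (lt_add_one b).trans_le (le_max_right _ _),
      fun t ht => hT t ((le_max_left _ _).trans ht)⟩
  · exact fun t₀ ht₀ => (hray t₀ ht₀).asymptotics t₀ (hc t₀ ht₀)

/-- Points of a ray at different potentials are distinct modulo the period of `exp`: otherwise they
would have the same image, but their orbits escape at different speeds. -/
theorem ne_add_two_pi_I (hg : IsRayCurve κ s a g) {t t' : ℝ} (ht : a < t) (ht' : a < t')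
    (hne : t ≠ t') (k : ℤ) : g t ≠ g t' + k * (2 * Real.pi * Complex.I) := by
  wlog hlt : t' < t generalizing t t' k
  · intro heq
    refine this ht' ht hne.symm (-k) (lt_of_le_of_ne (not_lt.1 hlt) hne) ?_
    rw [heq]; push_cast; ring
  intro heq
  have hE : E κ (g t) = E κ (g t') := by
    rw [heq]
    simp only [E]
    rw [Complex.exp_add, Complex.exp_int_mul_two_pi_mul_I, mul_one]
  obtain ⟨R, hR⟩ := hg.asymptotics t' ht' 1 one_pos
  obtain ⟨n, hn1, hn2, hn3⟩ := ((tendsto_F_iterate_sub (hg.nonneg.trans_lt ht') hlt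
    |>.eventually_gt_atTop 2).and ((tendsto_natCast_atTop_atTop.eventually_ge_atTop R).and
      (eventually_ge_atTop 1))).exists
  have h1 := abs_lt.1 (hR n t hlt.le (Or.inl hn2))
  have h2 := abs_lt.1 (hR n t' le_rfl (Or.inl hn2))
  obtain ⟨m, rfl⟩ : ∃ m, n = m + 1 := ⟨n - 1, by omega⟩
  rw [Function.iterate_succ_apply (E κ), hE, ← Function.iterate_succ_apply (E κ)] at h1
  linarith [h1.1, h1.2, h2.1, h2.2]

end IsRayCurve

/-! ### Rays at large potentials -/

/-- The `n`-th approximation to the ray at address `s`: start at the model point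
`F^n t + 2 π i s_{n+1}` and pull it back `n` times along the branches of `E κ ⁻¹` prescribed
by `s`. -/
noncomputable def approxRay (κ : ℂ) : ℕ → Address → ℝ → ℂ
  | 0, s, t => t + 2 * Real.pi * Complex.I * s 0
  | n + 1, s, t => Complex.log (approxRay κ n (shift s) (F t) - κ) + 2 * Real.pi * Complex.I * s 0

/-- The limit of the approximations `approxRay κ n s t` as `n → ∞`. It is only meaningful for
large `t`, where they converge. -/
noncomputable def tailRay (κ : ℂ) (s : Address) (t : ℝ) : ℂ :=
  limUnder atTop fun n => approxRay κ n s t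

section Tail

variable {κ : ℂ} {s : Address} {t C K M : ℝ}

theorem norm_two_pi_I_mul_int (m : ℤ) :
    ‖(2 * Real.pi * Complex.I * m : ℂ)‖ = 2 * Real.pi * |(m : ℝ)| := by
  simp [abs_of_pos Real.pi_pos]

/-- If `z` is within `C` of `exp t` and `t` is large, then `log z` is within `2 C exp (-t)` of `t`. -/
theorem norm_log_sub_le {z : ℂ} (hC : 2 ≤ C) (ht : 4 * C ≤ t) (hz : ‖z - Real.exp t‖ ≤ C) :
    2 ≤ z.re ∧ ‖Complex.log z - t‖ ≤ 2 * C * Real.exp (-t) := by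
  have he := Real.exp_pos t
  have het : 4 * C ≤ Real.exp t := ht.trans (by linarith [Real.add_one_le_exp t])
  have hre := (Complex.abs_re_le_norm _).trans hz
  rw [Complex.sub_re, Complex.ofReal_re, abs_le] at hre
  refine ⟨by linarith [hre.1], ?_⟩
  set η : ℂ := (z - Real.exp t) * Real.exp (-t) with hη
  have hηn : ‖η‖ ≤ C * Real.exp (-t) := by
    rw [hη, norm_mul, Complex.norm_real, Real.norm_of_nonneg (Real.exp_pos _).le]
    gcongr
  have hη2 : ‖η‖ ≤ 1 / 2 := by
    refine hηn.trans ?_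
    rw [Real.exp_neg, ← div_eq_mul_inv, div_le_iff₀ he]; linarith
  have hee : (Real.exp t : ℂ) * Real.exp (-t) = 1 := by
    rw [← Complex.ofReal_mul, ← Real.exp_add]; simp
  have hzη : z = Real.exp t * (1 + η) := by
    rw [hη]; linear_combination (-(z - Real.exp t)) * hee
  have hne : 1 + η ≠ 0 := by
    intro h0
    rw [h0, mul_zero] at hzη
    rw [hzη] at hre; simp at hre; linarith [hre.1]
  rw [hzη, Complex.log_ofReal_mul he hne, Real.log_exp, add_sub_cancel_left]
  refine (Complex.norm_log_one_add_half_le_self hη2).trans ?_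
  linarith [norm_nonneg η]

/-- A point within `1` of the model point `F t + 2πi m` is, relative to `κ`, within a bounded distance
of `exp t`. -/
theorem norm_sub_exp_le {w : ℂ} (hκ : ‖κ‖ ≤ K) {m : ℤ} (hm : |(m : ℝ)| ≤ M)
    (hw : ‖w - ((F t : ℝ) + 2 * Real.pi * Complex.I * m)‖ ≤ 1) :
    ‖w - κ - Real.exp t‖ ≤ 2 + 2 * Real.pi * M + K := by
  have h1 : w - κ - Real.exp t = (w - ((F t : ℝ) + 2 * Real.pi * Complex.I * m)) +
      (2 * Real.pi * Complex.I * m - 1 - κ) := by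
    simp only [F]; push_cast; ring
  have h2 := norm_sub_le (2 * Real.pi * Complex.I * m - 1) κ
  have h3 := norm_sub_le (2 * Real.pi * Complex.I * m : ℂ) 1
  rw [norm_two_pi_I_mul_int, norm_one] at h3
  have h4 : 2 * Real.pi * |(m : ℝ)| ≤ 2 * Real.pi * M := by
    have := Real.pi_pos
    gcongr
  rw [h1]
  refine (norm_add_le _ _).trans ?_
  linarith

/-- The potential from which on the approximations converge, for all `κ` of modulus at most `K`
and all addresses with entries of modulus at most `M`. -/
noncomputable def tailStart (K M : ℝ) : ℝ := 4 * (2 + 2 * Real.pi * M + K)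

theorem tailStart_pos (hK : 0 ≤ K) (hM : 0 ≤ M) : 0 < tailStart K M := by
  have := Real.pi_pos
  unfold tailStart; positivity

theorem two_le_of_nonneg (hK : 0 ≤ K) (hM : 0 ≤ M) : 2 ≤ 2 + 2 * Real.pi * M + K := by
  have : 0 ≤ 2 * Real.pi * M := by have := Real.pi_pos; positivity
  linarith

theorem two_mul_mul_exp_neg_le (hC : 2 ≤ C) (ht : 4 * C ≤ t) : 2 * C * Real.exp (-t) ≤ 1 := by
  rw [Real.exp_neg, ← div_eq_mul_inv, div_le_iff₀ (Real.exp_pos t)]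
  linarith [Real.add_one_le_exp t]

/-- The approximations stay within `1` of the model point, because one pullback brings points within
`1` of the model point at `F t` even closer to the model point at `t`. -/
theorem norm_approxRay_sub_le (hK : ‖κ‖ ≤ K) (hs : ∀ k, |(s k : ℝ)| ≤ M)
    (ht : tailStart K M ≤ t) (n : ℕ) :
    ‖approxRay κ n s t - (t + 2 * Real.pi * Complex.I * s 0)‖ ≤ 1 := by
  have hC := two_le_of_nonneg ((norm_nonneg κ).trans hK) ((abs_nonneg _).trans (hs 0))
  induction n generalizing s t with
  | zero => simp [approxRay]
  | succ n ih =>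
    have h1 := norm_log_sub_le hC ht
      (norm_sub_exp_le hK (hs 1) (ih (s := shift s) (fun k => hs (k + 1)) (ht.trans (le_F t))))
    rw [approxRay, add_sub_add_right_eq_sub]
    exact h1.2.trans (two_mul_mul_exp_neg_le hC ht)

theorem two_le_re_approxRay_sub (hK : ‖κ‖ ≤ K) (hs : ∀ k, |(s k : ℝ)| ≤ M)
    (ht : tailStart K M ≤ t) (n : ℕ) : 2 ≤ (approxRay κ n (shift s) (F t) - κ).re :=
  (norm_log_sub_le (two_le_of_nonneg ((norm_nonneg κ).trans hK) ((abs_nonneg _).trans (hs 0))) ht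
    (norm_sub_exp_le hK (hs 1) (norm_approxRay_sub_le hK (s := shift s) (fun k => hs (k + 1))
      (ht.trans (le_F t)) n))).1

theorem dist_approxRay_succ_le (hK : ‖κ‖ ≤ K) (hs : ∀ k, |(s k : ℝ)| ≤ M)
    (ht : tailStart K M ≤ t) (n : ℕ) :
    dist (approxRay κ n s t) (approxRay κ (n + 1) s t) ≤ 1 * (1 / 2) ^ n := by
  rw [dist_eq_norm, one_mul]
  induction n generalizing s t with
  | zero =>
    rw [← norm_neg, neg_sub]
    simpa [approxRay] using norm_approxRay_sub_le hK hs ht 1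
  | succ n ih =>
    have h1 := norm_log_sub_log_le (two_le_re_approxRay_sub hK hs ht n)
      (two_le_re_approxRay_sub hK hs ht (n + 1))
    rw [sub_sub_sub_cancel_right] at h1
    have h2 := ih (s := shift s) (fun k => hs (k + 1)) (ht.trans (le_F t))
    rw [approxRay, approxRay, add_sub_add_right_eq_sub, pow_succ]
    linarith

theorem tendsto_approxRay (hK : ‖κ‖ ≤ K) (hs : ∀ k, |(s k : ℝ)| ≤ M)
    (ht : tailStart K M ≤ t) :
    Tendsto (fun n => approxRay κ n s t) atTop (𝓝 (tailRay κ s t)) :=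
  CauchySeq.tendsto_limUnder
    (cauchySeq_of_le_geometric _ _ (by norm_num) (dist_approxRay_succ_le hK hs ht))

theorem tendstoUniformlyOn_approxRay (hs : ∀ k, |(s k : ℝ)| ≤ M) :
    TendstoUniformlyOn (fun n (p : ℂ × ℝ) => approxRay p.1 n s p.2)
      (fun p => tailRay p.1 s p.2) atTop (closedBall 0 K ×ˢ Ici (tailStart K M)) := by
  rw [Metric.tendstoUniformlyOn_iff]
  intro ε hε
  have h1 : Tendsto (fun n : ℕ => 1 * (1 / 2 : ℝ) ^ n / (1 - 1 / 2)) atTop (𝓝 0) := by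
    simpa using ((tendsto_pow_atTop_nhds_zero_of_lt_one (by norm_num)
      (by norm_num : (1 / 2 : ℝ) < 1)).const_mul 1).div_const (1 - 1 / 2)
  filter_upwards [h1.eventually (gt_mem_nhds hε)] with n hn p hp
  have hp1 : ‖p.1‖ ≤ K := by simpa using hp.1
  rw [dist_comm]
  exact (dist_le_of_le_geometric_of_tendsto _ _ (by norm_num) (dist_approxRay_succ_le hp1 hs hp.2)
    (tendsto_approxRay hp1 hs hp.2) n).trans_lt hn

theorem continuousOn_approxRay (hs : ∀ k, |(s k : ℝ)| ≤ M) (n : ℕ) :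
    ContinuousOn (fun p : ℂ × ℝ => approxRay p.1 n s p.2)
      (closedBall 0 K ×ˢ Ici (tailStart K M)) := by
  induction n generalizing s with
  | zero => simp only [approxRay]; fun_prop
  | succ n ih =>
    simp only [approxRay]
    refine ContinuousOn.add (ContinuousOn.clog (ContinuousOn.sub ?_ (by fun_prop)) ?_)
      continuousOn_const
    · have h1 : ContinuousOn (fun p : ℂ × ℝ => (p.1, F p.2))
          (closedBall 0 K ×ˢ Ici (tailStart K M)) :=
        (continuous_fst.prodMk (continuous_F.comp continuous_snd)).continuousOn
      exact (ih (s := shift s) fun k => hs (k + 1)).comp h1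
        fun p hp => ⟨hp.1, le_trans hp.2 (le_F p.2)⟩
    · intro p hp
      have := two_le_re_approxRay_sub (by simpa using hp.1) hs hp.2 n
      exact Or.inl (by linarith)

theorem differentiableOn_approxRay (hs : ∀ k, |(s k : ℝ)| ≤ M) (ht : tailStart K M ≤ t) (n : ℕ) :
    DifferentiableOn ℂ (fun κ => approxRay κ n s t) (ball 0 K) := by
  induction n generalizing s t with
  | zero => simp only [approxRay]; fun_prop
  | succ n ih =>
    simp only [approxRay]
    refine DifferentiableOn.add_const _ (DifferentiableOn.clog (DifferentiableOn.sub
      (ih (s := shift s) (fun k => hs (k + 1)) (ht.trans (le_F t))) differentiableOn_id) ?_)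
    intro κ hκ
    have := two_le_re_approxRay_sub (by simpa using (ball_subset_closedBall hκ)) hs ht n
    exact Or.inl (by linarith)

theorem continuousOn_tailRay (hs : ∀ k, |(s k : ℝ)| ≤ M) :
    ContinuousOn (fun p : ℂ × ℝ => tailRay p.1 s p.2)
      (closedBall 0 K ×ˢ Ici (tailStart K M)) :=
  (tendstoUniformlyOn_approxRay hs).continuousOn
    (Eventually.of_forall fun n => continuousOn_approxRay hs n).frequently

theorem differentiableOn_tailRay (hs : ∀ k, |(s k : ℝ)| ≤ M) (ht : tailStart K M ≤ t) :
    DifferentiableOn ℂ (fun κ => tailRay κ s t) (ball 0 K) := by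
  have h1 : TendstoUniformlyOn (fun n κ => approxRay κ n s t) (fun κ => tailRay κ s t) atTop
      (ball 0 K) := by
    intro V hV
    filter_upwards [tendstoUniformlyOn_approxRay (K := K) hs V hV] with n hn κ hκ
    exact hn (κ, t) ⟨ball_subset_closedBall hκ, ht⟩
  exact h1.tendstoLocallyUniformlyOn.differentiableOn
    (Eventually.of_forall fun n => differentiableOn_approxRay hs ht n) isOpen_ball

theorem E_tailRay (hK : ‖κ‖ ≤ K) (hs : ∀ k, |(s k : ℝ)| ≤ M) (ht : tailStart K M ≤ t) :
    E κ (tailRay κ s t) = tailRay κ (shift s) (F t) := by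
  have h1 := ((continuous_E κ).tendsto _).comp
    ((tendsto_add_atTop_iff_nat 1).2 (tendsto_approxRay hK hs ht))
  have h2 := tendsto_approxRay hK (s := shift s) (fun k => hs (k + 1)) (ht.trans (le_F t))
  refine tendsto_nhds_unique h1 (h2.congr fun n => ?_)
  have h3 := two_le_re_approxRay_sub hK hs ht n
  have h4 : approxRay κ n (shift s) (F t) - κ ≠ 0 := by
    intro h0; rw [h0] at h3; simp at h3; linarith
  simp only [Function.comp_apply, approxRay, E]
  rw [mul_comm (2 * Real.pi * Complex.I : ℂ), Complex.exp_add, Complex.exp_int_mul_two_pi_mul_I,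
    Complex.exp_log h4]
  ring

theorem E_iterate_tailRay (hK : ‖κ‖ ≤ K) (hs : ∀ k, |(s k : ℝ)| ≤ M) (ht : tailStart K M ≤ t)
    (n : ℕ) : (E κ)^[n] (tailRay κ s t) = tailRay κ (shift^[n] s) (F^[n] t) := by
  induction n generalizing s t with
  | zero => rfl
  | succ n ih =>
    rw [Function.iterate_succ_apply, E_tailRay hK hs ht,
      ih (s := shift s) (fun k => hs (k + 1)) (ht.trans (le_F t)), ← Function.iterate_succ_apply,
      ← Function.iterate_succ_apply]

theorem norm_tailRay_sub_le (hK : ‖κ‖ ≤ K) (hs : ∀ k, |(s k : ℝ)| ≤ M)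
    (ht : tailStart K M ≤ t) :
    ‖tailRay κ s t - (t + 2 * Real.pi * Complex.I * s 0)‖ ≤
      2 * (2 + 2 * Real.pi * M + K) * Real.exp (-t) := by
  have hC := two_le_of_nonneg ((norm_nonneg κ).trans hK) ((abs_nonneg _).trans (hs 0))
  have h1 := ((tendsto_add_atTop_iff_nat 1).2 (tendsto_approxRay hK hs ht)).sub_const
    (t + 2 * Real.pi * Complex.I * s 0) |>.norm
  refine le_of_tendsto' h1 fun n => ?_
  rw [approxRay, add_sub_add_right_eq_sub]
  exact (norm_log_sub_le hC ht (norm_sub_exp_le hK (hs 1) (norm_approxRay_sub_le hK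
    (s := shift s) (fun k => hs (k + 1)) (ht.trans (le_F t)) n))).2

theorem norm_E_iterate_tailRay_sub_le (hK : ‖κ‖ ≤ K) (hs : ∀ k, |(s k : ℝ)| ≤ M)
    (ht : tailStart K M ≤ t) (n : ℕ) :
    ‖(E κ)^[n] (tailRay κ s t) - ((F^[n] t : ℝ) + 2 * Real.pi * Complex.I * s n)‖ ≤
      2 * (2 + 2 * Real.pi * M + K) * Real.exp (-(F^[n] t)) := by
  have h1 := norm_tailRay_sub_le hK (s := shift^[n] s) (t := F^[n] t)
    (fun k => by rw [shift_iterate_apply]; exact hs _) (ht.trans (le_F_iterate t n))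
  rwa [shift_iterate_apply, zero_add, ← E_iterate_tailRay hK hs ht] at h1

theorem isRayCurve_tailRay (hK : ‖κ‖ ≤ K) (hs : ∀ k, |(s k : ℝ)| ≤ M) :
    IsRayCurve κ s (tailStart K M) (tailRay κ s) := by
  have hK0 := (norm_nonneg κ).trans hK
  have hM0 := (abs_nonneg _).trans (hs 0)
  have hC := two_le_of_nonneg hK0 hM0
  have hT := tailStart_pos hK0 hM0
  have hle1 : ∀ t, tailStart K M ≤ t → ∀ n : ℕ,
      ‖(E κ)^[n] (tailRay κ s t) - ((F^[n] t : ℝ) + 2 * Real.pi * Complex.I * s n)‖ ≤ 1 :=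
    fun t ht n => (norm_E_iterate_tailRay_sub_le hK hs ht n).trans
      (two_mul_mul_exp_neg_le hC (ht.trans (le_F_iterate t n)))
  have hre : ∀ (t : ℝ) (n : ℕ), |((E κ)^[n] (tailRay κ s t)).re - F^[n] t| ≤
      ‖(E κ)^[n] (tailRay κ s t) - ((F^[n] t : ℝ) + 2 * Real.pi * Complex.I * s n)‖ := by
    intro t n
    refine le_trans (le_of_eq ?_) (Complex.abs_re_le_norm _)
    simp
  refine ⟨hT.le, ?_, ?_, ?_, ?_⟩
  · have h1 : ContinuousOn (fun t : ℝ => (κ, t)) (Ioi (tailStart K M)) := by fun_prop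
    have h2 : MapsTo (fun t : ℝ => (κ, t)) (Ioi (tailStart K M))
        (closedBall 0 K ×ˢ Ici (tailStart K M)) :=
      fun t ht => ⟨mem_closedBall_zero_iff.2 hK, Ioi_subset_Ici_self ht⟩
    simpa only [Function.comp_def] using (continuousOn_tailRay (K := K) hs).comp h1 h2
  · intro t ht
    refine tendsto_atTop_mono (fun n => ?_)
      (tendsto_atTop_add_const_right _ (-1) (tendsto_F_iterate (hT.trans ht)))
    have h1 := (abs_le.1 ((hre t n).trans (hle1 t ht.le n))).1
    have h2 := Complex.re_le_norm ((E κ)^[n] (tailRay κ s t))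
    linarith
  · refine ⟨tailStart K M + 1, lt_add_one _, fun t ht n => ?_⟩
    have h1 := (Complex.abs_im_le_norm _).trans (hle1 t (by linarith) n)
    have h2 : ((E κ)^[n] (tailRay κ s t) - ((F^[n] t : ℝ) + 2 * Real.pi * Complex.I * s n)).im =
        ((E κ)^[n] (tailRay κ s t)).im - 2 * Real.pi * s n := by simp
    rw [h2, abs_le] at h1
    have := Real.pi_gt_three
    constructor <;> nlinarith [h1.1, h1.2]
  · intro t₀ ht₀ ε hε
    have h1 : Tendsto (fun x : ℝ => 2 * (2 + 2 * Real.pi * M + K) * Real.exp (-x)) atTop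
        (𝓝 0) := by
      simpa using (Real.tendsto_exp_neg_atTop_nhds_zero).const_mul (2 * (2 + 2 * Real.pi * M + K))
    obtain ⟨X, hX⟩ := eventually_atTop.1 (h1.eventually (gt_mem_nhds hε))
    obtain ⟨N, hN⟩ := eventually_atTop.1
      ((tendsto_F_iterate (hT.trans ht₀)).eventually_ge_atTop X)
    refine ⟨max N X, fun n t ht h => ?_⟩
    refine ((hre t n).trans (norm_E_iterate_tailRay_sub_le hK hs (ht₀.le.trans ht) n)).trans_lt
      (hX _ ?_)
    rcases h with h | h
    · exact (hN n (by exact_mod_cast (le_max_left _ _).trans h)).trans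
        ((strictMono_F.iterate n).monotone ht)
    · exact ((le_max_right _ _).trans h).trans (le_F_iterate t n)

end Tail

/-! ### Holomorphic families of rays -/

/-- `G κ`, for `κ ∈ D`, is a ray curve of `E κ` at address `s` on `(a, ∞)` that depends
continuously on `(κ, t)` and holomorphically on `κ`. -/
structure IsRayFamily (D : Set ℂ) (s : Address) (a : ℝ) (G : ℂ → ℝ → ℂ) : Prop where
  cont : ContinuousOn (fun p : ℂ × ℝ => G p.1 p.2) (D ×ˢ Ioi a)
  isRayCurve : ∀ κ ∈ D, IsRayCurve κ s a (G κ)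
  differentiableOn : ∀ t, a < t → DifferentiableOn ℂ (fun κ => G κ t) D

theorem IsRayFamily.mono {D D' : Set ℂ} {s : Address} {a b : ℝ} {G : ℂ → ℝ → ℂ}
    (h : IsRayFamily D s a G) (hab : a ≤ b) (hD : D' ⊆ D) : IsRayFamily D' s b G where
  cont := h.cont.mono (prod_mono hD (Ioi_subset_Ioi hab))
  isRayCurve κ hκ := (h.isRayCurve κ (hD hκ)).mono hab
  differentiableOn t ht := (h.differentiableOn t (hab.trans_lt ht)).mono hD

theorem isRayFamily_tailRay {s : Address} {K M : ℝ} (hs : ∀ k, |(s k : ℝ)| ≤ M) :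
    IsRayFamily (ball 0 K) s (tailStart K M) (fun κ => tailRay κ s) where
  cont := (continuousOn_tailRay hs).mono (prod_mono ball_subset_closedBall Ioi_subset_Ici_self)
  isRayCurve κ hκ := isRayCurve_tailRay (by simpa using ball_subset_closedBall hκ) hs
  differentiableOn t ht := differentiableOn_tailRay hs (le_of_lt ht)

/-- Pulling a family of rays back: a family at address `shift s` on `(F a, ∞)` that avoids the
singular values `κ` lifts under `E κ` to a family on `(a, ∞)`, and the lift that extends the given
rays `B κ` at address `s` is a family of rays at `s`. -/
theorem IsRayFamily.exists_pullback {D : Set ℂ} {s : Address} {a T : ℝ} {H B B' : ℂ → ℝ → ℂ}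
    (hDo : IsOpen D) (hDc : Convex ℝ D) (hDn : D.Nonempty) (ha : 0 < a)
    (hH : IsRayFamily D (shift s) (F a) H) (hB : IsRayFamily D s T B)
    (hB' : IsRayFamily D (shift s) T B')
    (hBB' : ∀ κ ∈ D, ∀ t, T < t → E κ (B κ t) = B' κ (F t))
    (hne : ∀ κ ∈ D, ∀ t, F a < t → H κ t ≠ κ) : ∃ G, IsRayFamily D s a G := by
  have hconv : Convex ℝ (D ×ˢ Ioi a) := hDc.prod (convex_Ioi a)
  set q : ℂ × ℝ → ℂ := fun p => H p.1 (F p.2) - p.1 with hq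
  have hqc : ContinuousOn q (D ×ˢ Ioi a) := by
    have h1 : ContinuousOn (fun p : ℂ × ℝ => (p.1, F p.2)) (D ×ˢ Ioi a) :=
      (continuous_fst.prodMk (continuous_F.comp continuous_snd)).continuousOn
    exact (hH.cont.comp h1 fun p hp => ⟨hp.1, strictMono_F hp.2⟩).sub continuousOn_fst
  obtain ⟨L, hLc, hL⟩ := Complex.exists_continuousOn_eqOn_exp_comp
    (isSimplyConnected_of_convex hconv (hDn.prod nonempty_Ioi)) (hDo.prod isOpen_Ioi) hqc
    (by
      rintro ⟨p, hp, hp0⟩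
      exact hne p.1 hp.1 _ (strictMono_F hp.2) (sub_eq_zero.1 hp0))
  set T' := max T a with hT'
  have hexpB : ∀ p ∈ D ×ˢ Ioi T', Complex.exp (B p.1 p.2) = q p := by
    rintro ⟨κ, t⟩ ⟨hκ, ht⟩
    have htT : T < t := (le_max_left _ _).trans_lt ht
    have hta : a < t := (le_max_right _ _).trans_lt ht
    have h1 := hBB' κ hκ t htT
    rw [(hB'.isRayCurve κ hκ).eqOn (hH.isRayCurve κ hκ)
      (max_lt (htT.trans_le (le_F t)) (strictMono_F hta))] at h1
    simp only [hq, ← h1, E]; ring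
  have hsub : D ×ˢ Ioi T' ⊆ D ×ˢ Ioi a :=
    prod_mono subset_rfl (Ioi_subset_Ioi (le_max_right _ _))
  -- Normalize the lift by a multiple of `2πi` so that it extends the given rays.
  obtain ⟨κc, hκc⟩ := hDn
  have hp₀ : (κc, T' + 1) ∈ D ×ˢ Ioi T' := ⟨hκc, lt_add_one T'⟩
  obtain ⟨m, hm⟩ := Complex.exp_eq_exp_iff_exists_int.1 ((hL (hsub hp₀)).trans (hexpB _ hp₀).symm)
  set G : ℂ → ℝ → ℂ := fun κ t => L (κ, t) - m * (2 * Real.pi * Complex.I) with hG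
  have hGc : ContinuousOn (fun p : ℂ × ℝ => G p.1 p.2) (D ×ˢ Ioi a) := hLc.sub continuousOn_const
  have hGexp : ∀ κ ∈ D, ∀ t, a < t → Complex.exp (G κ t) = H κ (F t) - κ := by
    intro κ hκ t ht
    have h1 : Complex.exp (L (κ, t)) = H κ (F t) - κ := hL (show (κ, t) ∈ D ×ˢ Ioi a from ⟨hκ, ht⟩)
    rw [hG, Complex.exp_sub, Complex.exp_int_mul_two_pi_mul_I, div_one, h1]
  have hGB : ∀ κ ∈ D, ∀ t, T' < t → G κ t = B κ t := by
    intro κ hκ t ht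
    refine eqOn_of_exp_eqOn (u := fun p : ℂ × ℝ => G p.1 p.2) (v := fun p => B p.1 p.2)
      (hDc.prod (convex_Ioi T')).isPreconnected (hGc.mono hsub)
      (hB.cont.mono (prod_mono subset_rfl (Ioi_subset_Ioi (le_max_left _ _))))
      (fun p hp => ?_) hp₀ ?_ (show (κ, t) ∈ D ×ˢ Ioi T' from ⟨hκ, ht⟩)
    · rw [hexpB p hp]; exact hGexp p.1 hp.1 p.2 (hsub hp).2
    · simp only [hG, hm]; ring
  have hEG : ∀ κ ∈ D, ∀ t, a < t → E κ (G κ t) = H κ (F t) := by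
    intro κ hκ t ht
    rw [E, hGexp κ hκ t ht]; ring
  refine ⟨G, hGc, fun κ hκ => ⟨ha.le, ?_, ?_, ?_, ?_⟩, fun t ht => ?_⟩
  · have h1 : ContinuousOn (fun t : ℝ => (κ, t)) (Ioi a) := by fun_prop
    exact hGc.comp h1 fun t ht => ⟨hκ, ht⟩
  · intro t ht
    have h1 := (hH.isRayCurve κ hκ).escaping (F t) (strictMono_F ht)
    refine (tendsto_add_atTop_iff_nat 1).1 (Tendsto.congr (fun n => ?_) h1)
    rw [Function.iterate_succ_apply, hEG κ hκ t ht]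
  · obtain ⟨T₁, -, h1⟩ := (hB.isRayCurve κ hκ).address
    refine ⟨max T₁ (T' + 1), ?_, fun t ht => ?_⟩
    · exact ((le_max_right _ _).trans_lt (lt_add_one T')).trans_le (le_max_right _ _)
    · rw [hGB κ hκ t ((lt_add_one T').trans_le ((le_max_right _ _).trans ht))]
      exact h1 t ((le_max_left _ _).trans ht)
  · intro t₀ ht₀ ε hε
    have hT'0 : 0 < T' := ha.trans_le (le_max_right _ _)
    obtain ⟨R₁, hR₁⟩ := (hH.isRayCurve κ hκ).asymptotics (F t₀) (strictMono_F ht₀) ε hε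
    obtain ⟨R₂, hR₂⟩ := (hB.isRayCurve κ hκ).asymptotics (T' + 1)
      ((le_max_left _ _).trans_lt (lt_add_one T')) ε hε
    refine ⟨max (R₁ + 1) (max R₂ (T' + 1)), fun n t ht h => ?_⟩
    simp only [max_le_iff] at h
    -- For `n = 0` only large `t` matter, where the curve is the given ray; for `n ≥ 1` the estimate
    -- is that of the family at `shift s`.
    cases n with
    | zero =>
      rcases h with h | h
      · have := h.2.2; push_cast at this; linarith
      · have h2 := hR₂ 0 t h.2.2 (Or.inr h.2.1)
        rwa [← hGB κ hκ t (by linarith [h.2.2])] at h2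
    | succ n =>
      rw [Function.iterate_succ_apply, Function.iterate_succ_apply, hEG κ hκ t (ht₀.trans_le ht)]
      refine hR₁ n (F t) (strictMono_F.monotone ht) ?_
      rcases h with h | h
      · left; have := h.1; push_cast at this; linarith
      · right; have := le_F t; linarith [h.1]
  · refine differentiableOn_of_exp_comp hDo ?_
      ((hH.differentiableOn (F t) (strictMono_F ht)).sub differentiableOn_id)
      (fun κ hκ => hGexp κ hκ t ht)
    have h1 : ContinuousOn (fun κ : ℂ => (κ, t)) D := by fun_prop
    exact hGc.comp h1 fun κ hκ => ⟨hκ, ht⟩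

/-- The parameter ray is defined by the maximal ray, so it accounts for all ray curves. -/
theorem IsRayCurve.ne_of_notMem_parameterRay {κ : ℂ} {s : Address} {a t : ℝ} {g : ℝ → ℂ}
    (hg : IsRayCurve κ s a g) (hκ : κ ∉ parameterRay s) (ht : a < t) : g t ≠ κ := by
  intro heq
  obtain ⟨b, h, hh⟩ := hg.exists_isDynamicRay
  obtain ⟨hba, hgh⟩ := hh.2 a g hg
  exact hκ ⟨b, h, hh, t, hba.trans_lt ht, by rw [← hgh ht, heq]⟩

/-- If the rays at the addresses `σⁿ s`, `n ≥ 1`, avoid the singular value for all parameters in a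
ball, then the ray at `s` can be pulled back, over this ball, to every positive potential. -/
theorem exists_isRayFamily {s : Address} (hs : IsBoundedAddress s) {c : ℂ} {r : ℝ} (hr : 0 < r)
    (hray : ∀ κ ∈ ball c r, ∀ n : ℕ, 1 ≤ n → κ ∉ parameterRay (shift^[n] s)) {a : ℝ}
    (ha : 0 < a) : ∃ G, IsRayFamily (ball c r) s a G := by
  obtain ⟨M, hM⟩ := hs
  have hMs : ∀ m k, |((shift^[m] s) k : ℝ)| ≤ (M : ℝ) := fun m k => by
    rw [shift_iterate_apply]; exact_mod_cast hM _
  set K := ‖c‖ + r with hK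
  have hsub : ball c r ⊆ ball 0 K := ball_subset_ball' (by rw [dist_zero_right, hK, add_comm])
  set T := tailStart K M with hT
  have htail : ∀ m, IsRayFamily (ball c r) (shift^[m] s) T (fun κ => tailRay κ (shift^[m] s)) :=
    fun m => (isRayFamily_tailRay (hMs m)).mono le_rfl hsub
  -- One pullback leads from `(F a, ∞)` to `(a, ∞)`, at the cost of one shift of the address.
  have key : ∀ (N : ℕ) (a : ℝ), 0 < a → T ≤ F^[N] a → ∀ m,
      ∃ G, IsRayFamily (ball c r) (shift^[m] s) a G := by
    intro N
    induction N with
    | zero => exact fun a _ haT m => ⟨_, (htail m).mono haT subset_rfl⟩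
    | succ N ih =>
      intro a ha haT m
      obtain ⟨H, hH⟩ := ih (F a) (F_pos ha) haT (m + 1)
      have hne : ∀ κ ∈ ball c r, ∀ t, F a < t → H κ t ≠ κ := fun κ hκ t ht =>
        (hH.isRayCurve κ hκ).ne_of_notMem_parameterRay (hray κ hκ _ (by omega)) ht
      have htail' := htail (m + 1)
      rw [Function.iterate_succ_apply'] at hH htail'
      refine hH.exists_pullback isOpen_ball (convex_ball c r) ⟨c, mem_ball_self hr⟩ ha (htail m)
        htail' (fun κ hκ t ht => ?_) hne
      exact E_tailRay (by simpa using ball_subset_closedBall (hsub hκ)) (hMs m) (le_of_lt ht)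
  obtain ⟨N, hN⟩ := ((tendsto_F_iterate ha).eventually_ge_atTop T).exists
  exact key N a ha hN 0

/-- Over an open set of parameters that avoids the parameter rays at `σⁿ s`, `n ≥ 1`, all dynamic
rays at `s` start at potential `0` and depend holomorphically on the parameter. -/
theorem exists_isDynamicRay_zero {s : Address} (hs : IsBoundedAddress s) {U : Set ℂ}
    (hU : IsOpen U) (hray : ∀ κ ∈ U, ∀ n : ℕ, 1 ≤ n → κ ∉ parameterRay (shift^[n] s)) :
    ∃ g : ℂ → ℝ → ℂ, (∀ κ ∈ U, IsDynamicRay κ s 0 (g κ)) ∧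
      ∀ t, 0 < t → DifferentiableOn ℂ (fun κ => g κ t) U := by
  have hfam : ∀ κ ∈ U, ∃ r, 0 < r ∧ ball κ r ⊆ U ∧
      ∀ a, 0 < a → ∃ G, IsRayFamily (ball κ r) s a G := by
    intro κ hκ
    obtain ⟨r, hr, hsub⟩ := Metric.isOpen_iff.1 hU κ hκ
    exact ⟨r, hr, hsub, fun a ha => exists_isRayFamily hs hr (fun x hx => hray x (hsub hx)) ha⟩
  have hex : ∀ κ ∈ U, ∃ g, IsDynamicRay κ s 0 g := by
    intro κ hκ
    obtain ⟨r, hr, -, hG⟩ := hfam κ hκ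
    have hcurve : ∀ a, 0 < a → ∃ g, IsRayCurve κ s a g := fun a ha =>
      (hG a ha).imp' (fun G => G κ) fun G h => h.isRayCurve κ (mem_ball_self hr)
    obtain ⟨g₁, hg₁⟩ := hcurve 1 one_pos
    obtain ⟨b, h, hh⟩ := hg₁.exists_isDynamicRay
    have hb : b = 0 := by
      refine le_antisymm (le_of_forall_gt_imp_ge_of_dense fun a ha => ?_) hh.1.nonneg
      obtain ⟨g, hg⟩ := hcurve a ha
      exact (hh.2 a g hg).1
    exact ⟨h, hb ▸ hh⟩
  choose! g hg using hex
  refine ⟨g, hg, fun t ht κ hκ => ?_⟩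
  obtain ⟨r, hr, hsub, hG⟩ := hfam κ hκ
  obtain ⟨G, hG⟩ := hG (t / 2) (half_pos ht)
  have heq : EqOn (fun κ => g κ t) (fun κ => G κ t) (ball κ r) := fun x hx =>
    (((hg x (hsub hx)).2 _ _ (hG.isRayCurve x hx)).2 (half_lt_self ht)).symm
  exact (((hG.differentiableOn t (half_lt_self ht)).congr heq).differentiableAt
    (ball_mem_nhds κ hr)).differentiableWithinAt

end ExpRays

theorem theorem3p1 (s : ExpRays.Address) (hs : ExpRays.IsBoundedAddress s) (U W : Set ℂ)
    (hU : U = (closure (⋃ n : ℕ, ⋃ _ : 1 ≤ n, ExpRays.parameterRay (ExpRays.shift^[n] s)))ᶜ)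
    (hW : ∃ κ₁ ∈ U, W = connectedComponentIn U κ₁)
    (κ₀ : ℂ) (hκ₀ : κ₀ ∈ W) (hland : ExpRays.Lands κ₀ s) :
    (∀ κ ∈ W, ExpRays.Lands κ s) ∧
      ∃ z : ℂ → ℂ, DifferentiableOn ℂ z W ∧ ∀ κ ∈ W, ExpRays.LandsAt κ s (z κ) := by
  have hUo : IsOpen U := by rw [hU]; exact isClosed_closure.isOpen_compl
  have hray : ∀ κ ∈ U, ∀ n : ℕ, 1 ≤ n → κ ∉ ExpRays.parameterRay (ExpRays.shift^[n] s) := by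
    intro κ hκ n hn hmem
    rw [hU] at hκ
    exact hκ (subset_closure (mem_iUnion₂.2 ⟨n, hn, hmem⟩))
  obtain ⟨κ₁, -, hWκ₁⟩ := hW
  have hWU : W ⊆ U := hWκ₁ ▸ connectedComponentIn_subset U κ₁
  have hWo : IsOpen W := hWκ₁ ▸ hUo.connectedComponentIn
  have hWc : IsPreconnected W := hWκ₁ ▸ isPreconnected_connectedComponentIn
  obtain ⟨g, hg, hgd⟩ := ExpRays.exists_isDynamicRay_zero hs hUo hray
  obtain ⟨z₀, g₀, hg₀, hlim₀⟩ := hland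
  have hlim : Tendsto (fun t => g κ₀ t) (𝓝[>] 0) (𝓝 z₀) :=
    hlim₀.congr' (by
      filter_upwards [self_mem_nhdsWithin] with t ht
      exact ((hg κ₀ (hWU hκ₀)).2 0 g₀ hg₀.1).2 ht)
  obtain ⟨z, hzd, hz⟩ := ExpRays.exists_differentiableOn_tendsto_of_disjoint_translates
    (f := fun t κ => g κ t) hWo hWc (fun t ht => (hgd t ht).mono hWU)
    (fun t ht t' ht' hne κ hκ k => (hg κ (hWU hκ)).1.ne_add_two_pi_I ht ht' hne k) hκ₀ hlim
  have hlands : ∀ κ ∈ W, ExpRays.LandsAt κ s (z κ) := fun κ hκ => ⟨g κ, hg κ (hWU hκ), hz κ hκ⟩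
  exact ⟨fun κ hκ => ⟨z κ, hlands κ hκ⟩, z, hzd, hlands⟩
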